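/- Let $G$ be a finite irreducible Coxeter group, that is, a finite group with a presentation $$G=\langle r_1,\dots,r_n \mid (r_ir_j)^{m_{ij}}=1 \text{ for all } i,j \text{ with } m_{ij}<\infty\rangle,$$ where $n\ge 1$, $m_{ii}=1$ and $m_{ij}=m_{ji}\in\{2,3,\dots\}\cup\{\infty\}$ for $i\ne j$, such that the Coxeter diagram (the graph on $\{1,\dots,n\}$ in which $i\neq j$ are joined when $m_{ij}>2$) is connected. Assume that the Coxeter matrix $(m_{ij})$ is not, up to relabelling the generators, of type $E_6$, $E_7$ or $E_8$. Then $G$ is mixable: there exist $k\ge 0$, elements $g_1,\dots,g_k\in G$ and $p_1,\dots,p_k\in[0,1]$ such that, if $\varepsilon_1,\dots,\varepsilon_k$ are independent random variables with $P(\varepsilon_i=1)=p_i$ and $P(\varepsilon_i=0)=1-p_i$, the random product $g_1^{\varepsilon_1}\cdots g_k^{\varepsilon_k}$ is uniformly distributed on $G$. -/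

import Mathlib

namespace Mixing

/-- The value `g₁^ε₁ ⋯ gₖ^εₖ` (multiplied in this order) of the subproduct of the fixed elements
`g₁, …, gₖ` for the outcome `ε ∈ {0,1}ᵏ` of the Bernoulli variables. -/
def subproduct {G : Type*} [Group G] {k : ℕ} (g : Fin k → G) (ε : Fin k → Bool) : G :=
  (List.ofFn fun i => if ε i then g i else 1).prod

/-- The probability of the outcome `ε ∈ {0,1}ᵏ` when `ε₁, …, εₖ` are independent Bernoulli
variables with `P(εᵢ = 1) = pᵢ`. -/
def outcomeProb {k : ℕ} (p : Fin k → ℝ) (ε : Fin k → Bool) : ℝ :=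
  ∏ i, if ε i then p i else 1 - p i

open Classical in
/-- The probability that the random subproduct `g₁^ε₁ ⋯ gₖ^εₖ`, with independent
`εᵢ ∼ Ber(pᵢ)`, takes the value `x`. -/
noncomputable def subproductProb {G : Type*} [Group G] {k : ℕ} (g : Fin k → G) (p : Fin k → ℝ)
    (x : G) : ℝ :=
  ∑ ε : Fin k → Bool, if subproduct g ε = x then outcomeProb p ε else 0

/-- A finite group is mixable if some random subproduct is distributed uniformly on it. -/
def IsMixable (G : Type*) [Group G] [Finite G] : Prop :=
  ∃ (k : ℕ) (g : Fin k → G) (p : Fin k → ℝ),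
    (∀ i, 0 ≤ p i ∧ p i ≤ 1) ∧ ∀ x : G, subproductProb g p x = 1 / (Nat.card G : ℝ)

/-- The Coxeter diagram: distinct generators `i`, `j` are joined when `m i j > 2`
(the value `0` of a Mathlib Coxeter matrix encodes `m i j = ∞`). -/
def coxeterDiagram {B : Type*} (M : CoxeterMatrix B) : SimpleGraph B where
  Adj i j := i ≠ j ∧ (2 < M i j ∨ M i j = 0)
  symm := ⟨fun i j h => by rw [M.symmetric j i]; exact ⟨h.1.symm, h.2⟩⟩
  loopless := ⟨fun _ h => h.1 rfl⟩

/-- A Coxeter matrix is irreducible if its diagram is connected (in particular nonempty). -/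
def IsIrreducible {B : Type*} (M : CoxeterMatrix B) : Prop :=
  (coxeterDiagram M).Connected

/-- `M` has the type of `N` if the two agree up to a bijective relabelling of the generators. -/
def HasType {B B' : Type*} (M : CoxeterMatrix B) (N : CoxeterMatrix B') : Prop :=
  ∃ e : B ≃ B', M.reindex e = N

end Mixing

/-!
A finite group `G` is mixable if and only if averaging over `G`, as an operator on `ℝ^G`, is a product
of lazy steps `(1 - p) + p g`. The theorem is proved by climbing a chain of parabolic subgroups of `G`:
a subgroup `K` is called reachable if averaging over `K` is a product of lazy steps, and reachability is
passed from `K` to a larger subgroup `H` by the **Gelfand criterion**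
`Reachable.of_inv_mem_doubleCoset`: it suffices that every double coset of `K` in `H` is closed under
inversion. In that case the operators `e h e`, where `h ∈ H` and `e` is the average over `K`, are
symmetric and commute. On the orthogonal complement of the `H`-invariants in the `K`-invariants they
add up to zero, and one of them is the identity, so another one has a negative eigenvalue `l`. Then
`e ((1 - p) + p h) e` with `p = 1 / (1 - l) ∈ [0, 1]` annihilates an eigenvector. Since all these
factors commute, finitely many of them annihilate the whole complement, and their product is the
average over `H`.

The double cosets are found from the Coxeter relations alone; that the standard generators of the
parabolic subgroups satisfy no further relations is never needed.
* In types A, B and D (`reachable_typeA`, `reachable_typeB`, `reachable_typeD`), adjoining the next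
  vertex `s` of the diagram to `K` gives `H = K ∪ K s K ∪ d K` with an involution `d` normalizing `K`,
  and this form is inherited by the next step (`Tower.step`).
* In a dihedral group, with `K` generated by one of the two reflections, every double coset contains an
  involution or the identity (`reachable_closure_pair`).
* For the steps from `B₃` to `F₄`, from `I₂(5)` to `H₃` and from `H₃` to `H₄`, a coset table is
  enumerated and checked by computation (`reachable_of_tableOk`).

With types E₆, E₇ and E₈ excluded, these steps reach every finite irreducible Coxeter group. This is
seen from a classification which extracts only what is needed. Averaging the
standard scalar product of the geometric representation over the finite group `G` shows that the
canonical form `⟨e_i, e_j⟩ = -cos (π / m_ij)` is positive definite (`form_pos`). A connected set of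
vertices can be contracted to a single vector of norm at most one, so the neighbours of the contracted
set satisfy `∑ ⟨e_p, e_s⟩ ^ 2 < 1` (`Light.star`); growing a connected set one vertex at a time shows
that the diagram is a path or a tripod (`shape_univ`). The star inequality and a few
vectors of norm zero or negative norm (`PosDefinite.tree`) restrict the labels and the lengths of the
arms to the list above.
-/

namespace Mixing

/-! ### Averaging operators and the Gelfand criterion -/

section Averaging

open scoped InnerProductSpace

variable {G : Type*} [Group G] [Fintype G]

/-- Left translation by `g` on the Euclidean space `ℝ^G` of real functions on `G`. -/
noncomputable def translation (G : Type*) [Group G] [Fintype G] :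
    G →* Module.End ℝ (EuclideanSpace ℝ G) where
  toFun g := (LinearIsometryEquiv.piLpCongrLeft 2 ℝ ℝ (Equiv.mulLeft g)).toLinearEquiv.toLinearMap
  map_one' := by
    ext x i
    simp [LinearIsometryEquiv.piLpCongrLeft_apply]
    rfl
  map_mul' g h := by
    ext x i
    simp [LinearIsometryEquiv.piLpCongrLeft_apply]
    rfl

lemma translation_apply (g : G) (x : EuclideanSpace ℝ G) (i : G) :
    translation G g x i = x (g⁻¹ * i) := by
  simp [translation, LinearIsometryEquiv.piLpCongrLeft_apply]

lemma inner_translation (g : G) (x y : EuclideanSpace ℝ G) :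
    ⟪translation G g x, y⟫_ℝ = ⟪x, translation G g⁻¹ y⟫_ℝ := by
  simp only [PiLp.inner_apply, translation_apply, inv_inv]
  refine Fintype.sum_equiv (Equiv.mulLeft g⁻¹) _ _ fun i => ?_
  simp

/-- The lazy step `(1 - p) + p g` acting on functions on `G`. -/
noncomputable def lazyStep (p : ℝ) (g : G) : Module.End ℝ (EuclideanSpace ℝ G) :=
  (1 - p) • 1 + p • translation G g

/-- The monoid of all products of lazy steps with probabilities in `[0, 1]`. -/
noncomputable def lazyMonoid (G : Type*) [Group G] [Fintype G] :
    Submonoid (Module.End ℝ (EuclideanSpace ℝ G)) :=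
  Submonoid.closure {T | ∃ (p : ℝ) (g : G), 0 ≤ p ∧ p ≤ 1 ∧ T = lazyStep p g}

open Classical in
/-- The operator `|H|⁻¹ ∑ h`, `h` running over the subgroup `H`. -/
noncomputable def average (H : Subgroup G) : Module.End ℝ (EuclideanSpace ℝ G) :=
  (Nat.card H : ℝ)⁻¹ • ∑ h : G with h ∈ H, translation G h

/-- A subgroup is *reachable* if averaging over it is a product of lazy steps. -/
def Reachable (H : Subgroup G) : Prop := average H ∈ lazyMonoid G

variable {H K : Subgroup G}

lemma card_smul_average (H : Subgroup G) [DecidablePred (· ∈ H)] :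
    (Nat.card H : ℝ) • average H = ∑ h : G with h ∈ H, translation G h := by
  rw [average, smul_inv_smul₀ (by simp)]
  congr!

lemma translation_mul_average {h : G} (hh : h ∈ H) :
    translation G h * average H = average H := by
  classical
  rw [average, mul_smul_comm, Finset.mul_sum]
  congr 1
  refine Finset.sum_equiv (Equiv.mulLeft h) (fun i => ?_) fun i _ => ?_
  · simp [H.mul_mem_cancel_left hh]
  · simp

lemma average_mul_translation {h : G} (hh : h ∈ H) :
    average H * translation G h = average H := by
  classical
  rw [average, smul_mul_assoc, Finset.sum_mul]
  congr 1
  refine Finset.sum_equiv (Equiv.mulRight h) (fun i => ?_) fun i _ => ?_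
  · simp [H.mul_mem_cancel_right hh]
  · simp

lemma card_filter_mem (H : Subgroup G) [DecidablePred (· ∈ H)] :
    (Finset.univ.filter (· ∈ H)).card = Nat.card H := by
  rw [Nat.card_eq_fintype_card, Fintype.card_subtype]

lemma average_mul_of_forall {T : Module.End ℝ (EuclideanSpace ℝ G)}
    (hT : ∀ h ∈ H, translation G h * T = T) : average H * T = T := by
  classical
  rw [average, smul_mul_assoc, Finset.sum_mul,
    Finset.sum_congr rfl (fun h hh => hT h (by simpa using hh)), Finset.sum_const,
    card_filter_mem, ← Nat.cast_smul_eq_nsmul ℝ, inv_smul_smul₀ (by simp)]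

lemma mul_average_of_forall {T : Module.End ℝ (EuclideanSpace ℝ G)}
    (hT : ∀ h ∈ H, T * translation G h = T) : T * average H = T := by
  classical
  rw [average, mul_smul_comm, Finset.mul_sum,
    Finset.sum_congr rfl (fun h hh => hT h (by simpa using hh)), Finset.sum_const,
    card_filter_mem, ← Nat.cast_smul_eq_nsmul ℝ, inv_smul_smul₀ (by simp)]

lemma average_mul_average_of_le (hKH : K ≤ H) : average K * average H = average H :=
  average_mul_of_forall fun _ hk => translation_mul_average (hKH hk)

lemma average_mul_average_of_ge (hKH : K ≤ H) : average H * average K = average H :=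
  mul_average_of_forall fun _ hk => average_mul_translation (hKH hk)

lemma inner_average (H : Subgroup G) (x y : EuclideanSpace ℝ G) :
    ⟪average H x, y⟫_ℝ = ⟪x, average H y⟫_ℝ := by
  classical
  simp only [average, LinearMap.smul_apply, LinearMap.sum_apply, inner_smul_left,
    inner_smul_right, sum_inner, inner_sum, inner_translation]
  congr 1
  exact Finset.sum_equiv (Equiv.inv G) (by simp) (by simp)

/-- A symmetric operator whose quadratic form takes a negative value has a negative eigenvalue. -/
lemma exists_neg_eigenvalue {E : Type*} [NormedAddCommGroup E] [InnerProductSpace ℝ E]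
    [FiniteDimensional ℝ E] {T : E →ₗ[ℝ] E} (hT : T.IsSymmetric) {w : E}
    (hw : ⟪w, T w⟫_ℝ < 0) : ∃ l : ℝ, l < 0 ∧ ∃ u : E, u ≠ 0 ∧ T u = l • u := by
  set b := hT.eigenvectorBasis rfl
  have hsum : ⟪w, T w⟫_ℝ = ∑ i, hT.eigenvalues rfl i * ⟪w, b i⟫_ℝ ^ 2 := by
    rw [← b.sum_inner_mul_inner]
    refine Finset.sum_congr rfl fun i _ => ?_
    rw [← hT, hT.apply_eigenvectorBasis rfl i, inner_smul_left, real_inner_comm w (b i)]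
    simp only [RCLike.ofReal_real_eq_id, id_eq, conj_trivial]
    ring
  obtain ⟨i, hi⟩ : ∃ i, hT.eigenvalues rfl i < 0 := by
    by_contra! h
    rw [hsum] at hw
    exact hw.not_ge (Finset.sum_nonneg fun i _ => mul_nonneg (h i) (sq_nonneg _))
  exact ⟨_, hi, b i, b.orthonormal.ne_zero i, hT.apply_eigenvectorBasis rfl i⟩

/-- The operator attached to the double coset `K h K`. -/
noncomputable def hecke (K : Subgroup G) (h : G) : Module.End ℝ (EuclideanSpace ℝ G) :=
  average K * translation G h * average K

lemma hecke_one : hecke K 1 = average K := by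
  rw [hecke, map_one, mul_one, average_mul_average_of_le le_rfl]

lemma hecke_mul_mul {k k' : G} (hk : k ∈ K) (hk' : k' ∈ K) (h : G) :
    hecke K (k * h * k') = hecke K h := by
  rw [hecke, map_mul, map_mul, mul_assoc, mul_assoc, translation_mul_average hk', ← mul_assoc,
    ← mul_assoc, average_mul_translation hk, hecke]

lemma inner_hecke (h : G) (x y : EuclideanSpace ℝ G) :
    ⟪hecke K h x, y⟫_ℝ = ⟪x, hecke K h⁻¹ y⟫_ℝ := by
  simp only [hecke, Module.End.mul_apply, inner_average, inner_translation]

lemma hecke_mul_hecke [DecidablePred (· ∈ K)] (g h : G) :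
    (Nat.card K : ℝ) • (hecke K g * hecke K h) = ∑ k : G with k ∈ K, hecke K (g * k * h) := by
  have : hecke K g * hecke K h
      = average K * translation G g * average K * (translation G h * average K) := by
    simp only [hecke, mul_assoc]
    rw [← mul_assoc (average K) (average K), average_mul_average_of_le le_rfl]
  rw [this, ← smul_mul_assoc, ← mul_smul_comm, card_smul_average, Finset.mul_sum, Finset.sum_mul]
  simp only [hecke, map_mul, mul_assoc]

lemma sum_hecke (hKH : K ≤ H) [DecidablePred (· ∈ H)] :
    ∑ h : G with h ∈ H, hecke K h = (Nat.card H : ℝ) • average H := by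
  simp only [hecke]
  rw [← Finset.sum_mul, ← Finset.mul_sum, ← card_smul_average, mul_smul_comm, smul_mul_assoc,
    average_mul_average_of_le hKH, average_mul_average_of_ge hKH]

section Gelfand

variable (hKH : K ≤ H) (hinv : ∀ h ∈ H, ∃ k ∈ K, ∃ k' ∈ K, h⁻¹ = k * h * k')
include hinv

lemma hecke_symmetric {h : G} (hh : h ∈ H) : (hecke K h).IsSymmetric := by
  intro x y
  obtain ⟨k, hk, k', hk', e⟩ := hinv h hh
  rw [inner_hecke, e, hecke_mul_mul hk hk']

include hKH

/-- The double coset operators commute: a product of two of them is a combination of symmetric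
operators, hence equal to its own adjoint. -/
lemma hecke_commute {g h : G} (hg : g ∈ H) (hh : h ∈ H) :
    Commute (hecke K g) (hecke K h) := by
  classical
  have hsymm : (hecke K g * hecke K h).IsSymmetric := by
    have h0 : (Nat.card K : ℝ) ≠ 0 := by simp
    intro x y
    have key : ⟪((Nat.card K : ℝ) • (hecke K g * hecke K h)) x, y⟫_ℝ
        = ⟪x, ((Nat.card K : ℝ) • (hecke K g * hecke K h)) y⟫_ℝ := by
      rw [hecke_mul_hecke]
      simp only [LinearMap.sum_apply, sum_inner, inner_sum]
      refine Finset.sum_congr rfl fun k hk => ?_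
      exact hecke_symmetric hinv
        (H.mul_mem (H.mul_mem hg (hKH (by simpa using hk))) hh) x y
    simpa [inner_smul_left, inner_smul_right, h0] using key
  refine LinearMap.ext fun y => ext_inner_left ℝ fun x => ?_
  rw [← hsymm x y, Module.End.mul_apply, Module.End.mul_apply,
    hecke_symmetric hinv hg, hecke_symmetric hinv hh]

/-- As long as a product `Q` of lazy steps commuting with the double coset operators differs from
`average H`, another factor `(1 - p) + p h` between two averagings over `K` lowers the rank of
`Q - average H`. -/
lemma reachable_of_commute (hK : Reachable K) (n : ℕ) :
    ∀ Q ∈ lazyMonoid G, (∀ h ∈ H, Commute Q (hecke K h)) → average K * Q = Q →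
      average H * Q = average H →
      Module.finrank ℝ (LinearMap.range (Q - average H)) = n → Reachable H := by
  classical
  induction n using Nat.strong_induction_on with
  | _ n ih =>
  intro Q hQ hcomm hKQ hHQ hn
  set W := LinearMap.range (Q - average H) with hW
  by_cases hbot : W = ⊥
  · rw [hW, LinearMap.range_eq_bot, sub_eq_zero] at hbot
    rwa [Reachable, ← hbot]
  have hKW : ∀ w ∈ W, average K w = w := by
    rintro _ ⟨x, rfl⟩
    rw [← Module.End.mul_apply, mul_sub, hKQ, average_mul_average_of_le hKH]
  have hHW : ∀ w ∈ W, average H w = 0 := by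
    rintro _ ⟨x, rfl⟩
    rw [← Module.End.mul_apply, mul_sub, hHQ, average_mul_average_of_le le_rfl, sub_self]
    rfl
  have htH : ∀ h ∈ H, average H * hecke K h = average H ∧ hecke K h * average H = average H := by
    intro h hh
    constructor
    · rw [hecke, ← mul_assoc, ← mul_assoc, average_mul_average_of_ge hKH,
        average_mul_translation hh, average_mul_average_of_ge hKH]
    · rw [hecke, mul_assoc, average_mul_average_of_le hKH, mul_assoc, translation_mul_average hh,
        average_mul_average_of_le hKH]
  have hinvW : ∀ h ∈ H, ∀ w ∈ W, hecke K h w ∈ W := by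
    rintro h hh _ ⟨x, rfl⟩
    refine ⟨hecke K h x, ?_⟩
    rw [← Module.End.mul_apply, ← Module.End.mul_apply, mul_sub, sub_mul, (htH h hh).1,
      (htH h hh).2, (hcomm h hh).eq]
  obtain ⟨w, hwW, hw0⟩ := W.ne_bot_iff.mp hbot
  -- The operators of the double cosets sum to zero on `W`, and that of the trivial one is the
  -- identity there; hence one of the quadratic forms is negative at `w`.
  obtain ⟨h, hh, hneg⟩ : ∃ h ∈ H, ⟪w, hecke K h w⟫_ℝ < 0 := by
    by_contra! hpos
    have hsum : ∑ h : G with h ∈ H, ⟪w, hecke K h w⟫_ℝ = 0 := by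
      rw [← inner_sum, ← LinearMap.sum_apply, sum_hecke hKH, LinearMap.smul_apply, hHW w hwW]
      simp
    rw [Finset.sum_eq_zero_iff_of_nonneg (fun h hh => hpos h (by simpa using hh))] at hsum
    have h1 := hsum 1 (by simp [H.one_mem])
    rw [hecke_one, hKW w hwW, inner_self_eq_zero] at h1
    exact hw0 h1
  obtain ⟨l, hl, ⟨u, huW⟩, hu0, hu⟩ :=
    exists_neg_eigenvalue ((hecke_symmetric hinv hh).restrict_invariant (hinvW h hh))
      (w := ⟨w, hwW⟩) (by simpa using hneg)
  replace hu : hecke K h u = l • u := congrArg Subtype.val hu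
  replace hu0 : u ≠ 0 := fun h0 => hu0 (Subtype.ext h0)
  -- With this value of `p`, the factor below annihilates the eigenvector `u`.
  set p : ℝ := (1 - l)⁻¹ with hp
  have hl1 : (1 : ℝ) - l ≠ 0 := by linarith
  set A : Module.End ℝ (EuclideanSpace ℝ G) := (1 - p) • average K + p • hecke K h with hA
  have hAlazy : A = average K * lazyStep p h * average K := by
    rw [lazyStep, mul_add, add_mul, mul_smul_comm, mul_smul_comm, smul_mul_assoc, smul_mul_assoc,
      mul_one, average_mul_average_of_le le_rfl, hA, hecke]
  have hAmem : A ∈ lazyMonoid G := by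
    rw [hAlazy]
    refine mul_mem (mul_mem hK (Submonoid.subset_closure ⟨p, h, ?_, ?_, rfl⟩)) hK
    · rw [hp, inv_nonneg]; linarith
    · rw [hp]; exact inv_le_one_of_one_le₀ (by linarith)
  have hAu : A u = 0 := by
    rw [hA, LinearMap.add_apply, LinearMap.smul_apply, LinearMap.smul_apply, hKW u huW, hu,
      smul_smul, ← add_smul]
    have : 1 - p + p * l = 0 := by rw [hp]; field_simp; ring
    rw [this, zero_smul]
  have hKA : average K * A = A := by
    rw [hAlazy, ← mul_assoc, ← mul_assoc, average_mul_average_of_le le_rfl]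
  have hHA : average H * A = average H ∧ A * average H = average H := by
    constructor
    · rw [hA, mul_add, mul_smul_comm, mul_smul_comm, average_mul_average_of_ge hKH, (htH h hh).1,
        ← add_smul, sub_add_cancel, one_smul]
    · rw [hA, add_mul, smul_mul_assoc, smul_mul_assoc, average_mul_average_of_le hKH,
        (htH h hh).2, ← add_smul, sub_add_cancel, one_smul]
  have hAQ : A * Q - average H = A * (Q - average H) := by rw [mul_sub, hHA.2]
  have hrank : Module.finrank ℝ (LinearMap.range (A * Q - average H)) < n := by
    have hr : LinearMap.range (A * Q - average H) = LinearMap.range (A.domRestrict W) := by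
      rw [hAQ, Module.End.mul_eq_comp, LinearMap.range_comp, LinearMap.range_domRestrict]
    have hker : LinearMap.ker (A.domRestrict W) ≠ ⊥ := by
      rw [Submodule.ne_bot_iff]
      exact ⟨⟨u, huW⟩, by simpa using hAu, fun h0 => hu0 (congrArg Subtype.val h0)⟩
    have := LinearMap.finrank_range_add_finrank_ker (A.domRestrict W)
    have h1 : 0 < Module.finrank ℝ (LinearMap.ker (A.domRestrict W)) :=
      Module.finrank_pos_iff.mpr (Submodule.nontrivial_iff_ne_bot.mpr hker)
    rw [hr]
    omega
  refine ih _ hrank (A * Q) (mul_mem hAmem hQ) (fun g hg => ?_) ?_ ?_ rfl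
  · refine Commute.mul_left ?_ (hcomm g hg)
    rw [hA, ← hecke_one]
    exact ((hecke_commute hKH hinv H.one_mem hg).smul_left _).add_left
      ((hecke_commute hKH hinv hh hg).smul_left _)
  · rw [← mul_assoc, hKA]
  · rw [← mul_assoc, hHA.1, hHQ]

/-- **Gelfand criterion.** If every double coset of `K` in `H` is closed under inversion and
averaging over `K` is a product of lazy steps, then so is averaging over `H`. -/
theorem Reachable.of_inv_mem_doubleCoset (hK : Reachable K) : Reachable H := by
  refine reachable_of_commute hKH hinv hK _ (average K) hK (fun h hh => ?_)
    (average_mul_average_of_le le_rfl) (average_mul_average_of_ge hKH) rfl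
  rw [← hecke_one]
  exact hecke_commute hKH hinv H.one_mem hh

end Gelfand

lemma reachable_bot : Reachable (⊥ : Subgroup G) := by
  classical
  have : average (⊥ : Subgroup G) = 1 := by
    have h1 : (Finset.univ.filter (· ∈ (⊥ : Subgroup G))) = {1} := by ext; simp
    rw [average, h1]
    simp
  rw [Reachable, this]
  exact one_mem _

/-! ### From products of lazy steps to random subproducts -/

lemma subproduct_cons {G : Type*} [Group G] {k : ℕ} (g : Fin (k + 1) → G) (b : Bool)
    (ε : Fin k → Bool) :
    subproduct g (Fin.cons b ε) = (if b then g 0 else 1) * subproduct (fun i => g i.succ) ε := by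
  simp [subproduct, List.ofFn_succ]

lemma outcomeProb_cons {k : ℕ} (p : Fin (k + 1) → ℝ) (b : Bool) (ε : Fin k → Bool) :
    outcomeProb p (Fin.cons b ε)
      = (if b then p 0 else 1 - p 0) * outcomeProb (fun i => p i.succ) ε := by
  simp [outcomeProb, Fin.prod_univ_succ]

lemma prod_lazyStep {k : ℕ} (g : Fin k → G) (p : Fin k → ℝ) :
    (List.ofFn fun i => lazyStep (p i) (g i)).prod
      = ∑ ε : Fin k → Bool, outcomeProb p ε • translation G (subproduct g ε) := by
  induction k with
  | zero => simp [outcomeProb, subproduct]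
  | succ k ih =>
    rw [List.ofFn_succ, List.prod_cons, ih (fun i => g i.succ) (fun i => p i.succ),
      ← (Fin.consEquiv fun _ => Bool).sum_comp, Fintype.sum_prod_type, Fintype.sum_bool]
    simp only [show ∀ (b : Bool) (ε : Fin k → Bool),
      (Fin.consEquiv fun _ => Bool) (b, ε) = Fin.cons b ε from fun _ _ => rfl]
    simp [subproduct_cons, outcomeProb_cons, lazyStep, add_mul, Finset.mul_sum, smul_smul,
      add_comm, mul_comm, Finset.sum_add_distrib]

lemma isMixable_of_reachable_top (h : Reachable (⊤ : Subgroup G)) : IsMixable G := by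
  classical
  obtain ⟨l, hl, hprod⟩ := Submonoid.exists_list_of_mem_closure h
  choose! p g hp0 hp1 hT using hl
  set T : Fin l.length → Module.End ℝ (EuclideanSpace ℝ G) := fun i => l.get i
  refine ⟨l.length, fun i => g (T i), fun i => p (T i), fun i =>
    ⟨hp0 _ (List.get_mem _ _), hp1 _ (List.get_mem _ _)⟩, fun x => ?_⟩
  have hl' : (List.ofFn fun i => lazyStep (p (T i)) (g (T i))) = l := by
    conv_rhs => rw [← List.ofFn_get l]
    exact congrArg _ (funext fun i => (hT _ (List.get_mem _ _)).symm)
  have key := prod_lazyStep (fun i => g (T i)) (fun i => p (T i))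
  rw [hl', hprod] at key
  -- Compare the values at `x` of the two operators applied to the indicator function of `1`.
  have := congrArg (fun A => A (EuclideanSpace.single 1 1) x) key
  simp only [average, LinearMap.smul_apply, LinearMap.sum_apply, PiLp.smul_apply,
    WithLp.ofLp_sum, Finset.sum_apply, translation_apply, smul_eq_mul, PiLp.single_apply,
    inv_mul_eq_one] at this
  simp only [mul_ite, mul_one, mul_zero, Subgroup.mem_top, Finset.filter_true,
    Finset.sum_ite_eq', Finset.mem_univ, if_true] at this
  rw [subproductProb, one_div, ← this, ← Subgroup.card_top (G := G)]
  rfl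

end Averaging

end Mixing

namespace Mixing

/-! ### Dihedral groups and the series A, B, D -/

section Towers

variable {G : Type*} [Group G]

lemma mem_of_mem_closure {S : Set G} {C : G → Prop} (h1 : C 1)
    (hmul : ∀ x ∈ S, ∀ y, C y → C (x * y)) (hinv : ∀ x ∈ S, x⁻¹ ∈ S) {g : G}
    (hg : g ∈ Subgroup.closure S) : C g := by
  induction hg using Subgroup.closure_induction_left with
  | one => exact h1
  | mul_left x hx y _ ih => exact hmul x hx y ih
  | inv_mul_cancel x hx y _ ih => exact hmul _ (hinv x hx) y ih

lemma inv_eq_self_of_sq {s : G} (hs : s * s = 1) : s⁻¹ = s := inv_eq_of_mul_eq_one_left hs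

lemma reachable_closure_singleton [Fintype G] {a : G} (ha : a * a = 1) :
    Reachable (Subgroup.closure {a}) := by
  refine Reachable.of_inv_mem_doubleCoset (K := ⊥) bot_le (fun h hh => ?_) reachable_bot
  have : h = 1 ∨ h = a := by
    refine mem_of_mem_closure (C := fun h => h = 1 ∨ h = a) (Or.inl rfl) ?_ ?_ hh
    · rintro x rfl y (rfl | rfl)
      · simp
      · simp [ha]
    · rintro x rfl
      simp [inv_eq_self_of_sq ha]
  refine ⟨1, one_mem _, 1, one_mem _, ?_⟩
  rcases this with rfl | rfl
  · simp
  · simp [inv_eq_self_of_sq ha]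

/-- A group generated by two involutions `a`, `b` is reachable: conjugation by `a` inverts `a b`. -/
lemma reachable_closure_pair [Fintype G] {a b : G} (ha : a * a = 1) (hb : b * b = 1) :
    Reachable (Subgroup.closure {a, b}) := by
  have ha' := inv_eq_self_of_sq ha
  have hb' := inv_eq_self_of_sq hb
  refine Reachable.of_inv_mem_doubleCoset (K := Subgroup.closure {a})
    (Subgroup.closure_mono (by simp)) (fun h hh => ?_) (reachable_closure_singleton ha)
  have haK : a ∈ Subgroup.closure {a} := Subgroup.subset_closure rfl
  have hconj : ∀ n : ℤ, a * (a * b) ^ n * a = (a * b) ^ (-n) := by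
    intro n
    have : a * (a * b) ^ n * a⁻¹ = (a * (a * b) * a⁻¹) ^ n := (conj_zpow).symm
    rw [ha', show a * (a * b) * a = (a * b)⁻¹ by
      rw [mul_inv_rev, ha', hb', ← mul_assoc, ha, one_mul]] at this
    rw [this, inv_zpow, zpow_neg]
  have hcase : ∃ n : ℤ, h = (a * b) ^ n ∨ h = (a * b) ^ n * a := by
    refine mem_of_mem_closure (C := fun h => ∃ n : ℤ, h = (a * b) ^ n ∨ h = (a * b) ^ n * a)
      ⟨0, by simp⟩ ?_ ?_ hh
    · have haa : ∀ n : ℤ, a * (a * b) ^ n = (a * b) ^ (-n) * a := fun n => by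
        rw [← hconj, mul_assoc, ha, mul_one]
      have hab : ∀ n : ℤ, b * (a * b) ^ n = (a * b) ^ (-n - 1) * a := fun n => by
        have : b = (a * b) ^ (-1 : ℤ) * a := by
          rw [zpow_neg_one, mul_inv_rev, ha', hb', mul_assoc, ha, mul_one]
        calc b * (a * b) ^ n = (a * b) ^ (-1 : ℤ) * (a * (a * b) ^ n) := by
              rw [← mul_assoc, ← this]
          _ = (a * b) ^ (-n - 1) * a := by
              rw [haa, ← mul_assoc, ← zpow_add, add_comm, ← sub_eq_add_neg]
      rintro x (rfl | rfl) y ⟨n, rfl | rfl⟩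
      · exact ⟨-n, Or.inr (haa n)⟩
      · exact ⟨-n, Or.inl (by rw [← mul_assoc, haa, mul_assoc, ha, mul_one])⟩
      · exact ⟨-n - 1, Or.inr (hab n)⟩
      · exact ⟨-n - 1, Or.inl (by rw [← mul_assoc, hab, mul_assoc, ha, mul_one])⟩
    · rintro x (rfl | rfl)
      · simp [ha']
      · simp [hb']
  obtain ⟨n, rfl | rfl⟩ := hcase
  · exact ⟨a, haK, a, haK, by rw [hconj, zpow_neg]⟩
  · refine ⟨1, one_mem _, 1, one_mem _, ?_⟩
    rw [one_mul, mul_one, mul_inv_rev, ha', ← zpow_neg, ← hconj, ← mul_assoc, ← mul_assoc, ha,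
      one_mul]

lemma conj_mem_of_mem_closure {S : Set G} {H : Subgroup G} {d : G} (hd : d * d = 1)
    (h : ∀ x ∈ S, d * x * d ∈ H) : ∀ g ∈ Subgroup.closure S, d * g * d ∈ H := by
  have hinv := inv_eq_self_of_sq hd
  have : Subgroup.closure S ≤ H.comap (MulAut.conj d).toMonoidHom := by
    rw [Subgroup.closure_le]
    intro x hx
    have := h x hx
    simpa [hinv] using this
  intro g hg
  simpa [hinv] using this hg

/-- `Tower K H s d` records that `H = K ∪ K s K ∪ d K`, where `s` is an involution and `d` is an
involution which normalizes `K` and is conjugate under `s` to an element of `K`. -/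
structure Tower (K H : Subgroup G) (s d : G) : Prop where
  le : K ≤ H
  mem : s ∈ H
  mem' : d ∈ H
  sq : s * s = 1
  sq' : d * d = 1
  conj_mem : ∀ k ∈ K, d * k * d ∈ K
  factor : ∃ c ∈ K, d = s * c * s
  cover : ∀ g ∈ H, g ∈ K ∨ (∃ a ∈ K, ∃ b ∈ K, g = a * s * b) ∨ ∃ a ∈ K, g = d * a

variable {K H : Subgroup G} {s d : G}

lemma Tower.reachable [Fintype G] (h : Tower K H s d) (hK : Reachable K) : Reachable H := by
  refine Reachable.of_inv_mem_doubleCoset h.le (fun g hg => ?_) hK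
  rcases h.cover g hg with hg | ⟨a, ha, b, hb, rfl⟩ | ⟨a, ha, rfl⟩
  · exact ⟨g⁻¹, inv_mem hg, g⁻¹, inv_mem hg, by group⟩
  · refine ⟨b⁻¹ * a⁻¹, mul_mem (inv_mem hb) (inv_mem ha), b⁻¹ * a⁻¹,
      mul_mem (inv_mem hb) (inv_mem ha), ?_⟩
    rw [mul_inv_rev, mul_inv_rev, inv_eq_self_of_sq h.sq]
    group
  · refine ⟨a⁻¹, inv_mem ha, a⁻¹, inv_mem ha, ?_⟩
    rw [mul_inv_rev, inv_eq_self_of_sq h.sq']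
    group

/-- Adjoining an involution `s` which commutes with `K` and satisfies the braid relation with the
elements of `T`, where `H = K ∪ K T K ∪ d K`. -/
lemma Tower.adjoin {T : Set G} (hKH : K ≤ H) (hTH : T ⊆ H) (hdH : d ∈ H) (hd : d * d = 1)
    (hcov : ∀ g ∈ H, g ∈ K ∨ (∃ a ∈ K, ∃ t ∈ T, ∃ b ∈ K, g = a * t * b) ∨
      ∃ a ∈ K, g = d * a)
    (hs : s * s = 1) (hsK : ∀ k ∈ K, s * k = k * s) (hsT : ∀ t ∈ T, s * t * s = t * s * t)
    (hnorm : ∀ h ∈ H, s * d * s * h * (s * d * s) ∈ H) :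
    Tower H (Subgroup.closure (insert s (H : Set G))) s (s * d * s) := by
  have hd' : s * d * s * (s * d * s) = 1 := by
    calc s * d * s * (s * d * s) = s * d * (s * s) * d * s := by group
      _ = s * (d * d) * s := by rw [hs]; group
      _ = 1 := by rw [hd, mul_one, hs]
  have hle : H ≤ Subgroup.closure (insert s (H : Set G)) := fun h hh =>
    Subgroup.subset_closure (Or.inr hh)
  have hsm : s ∈ Subgroup.closure (insert s (H : Set G)) :=
    Subgroup.subset_closure (Or.inl rfl)
  refine ⟨hle, hsm, mul_mem (mul_mem hsm (hle hdH)) hsm, hs, hd', hnorm, ⟨d, hdH, rfl⟩, ?_⟩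
  intro g hg
  refine mem_of_mem_closure (C := fun g => g ∈ H ∨ (∃ a ∈ H, ∃ b ∈ H, g = a * s * b) ∨
    ∃ a ∈ H, g = s * d * s * a) (Or.inl (one_mem _)) ?_ ?_ hg
  · rintro x (rfl | hx) y hy
    · rcases hy with hy | ⟨a, ha, b, hb, rfl⟩ | ⟨a, ha, rfl⟩
      · exact Or.inr (Or.inl ⟨1, one_mem _, y, hy, by group⟩)
      · rcases hcov a ha with hk | ⟨a₁, ha₁, t, ht, b₁, hb₁, rfl⟩ | ⟨a₁, ha₁, rfl⟩
        · refine Or.inl ?_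
          rw [← mul_assoc, ← mul_assoc, hsK a hk, mul_assoc a, hs, mul_one]
          exact mul_mem ha hb
        · refine Or.inr (Or.inl ⟨a₁ * t, mul_mem (hKH ha₁) (hTH ht), t * b₁ * b,
            mul_mem (mul_mem (hTH ht) (hKH hb₁)) hb, ?_⟩)
          calc x * (a₁ * t * b₁ * x * b) = (x * a₁) * t * b₁ * x * b := by group
            _ = a₁ * x * t * (b₁ * x) * b := by rw [hsK a₁ ha₁]; group
            _ = a₁ * (x * t * x) * b₁ * b := by rw [← hsK b₁ hb₁]; group
            _ = a₁ * t * x * (t * b₁ * b) := by rw [hsT t ht]; group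
        · refine Or.inr (Or.inr ⟨a₁ * b, mul_mem (hKH ha₁) hb, ?_⟩)
          calc x * (d * a₁ * x * b) = x * d * (a₁ * x) * b := by group
            _ = x * d * x * (a₁ * b) := by rw [← hsK a₁ ha₁]; group
      · refine Or.inr (Or.inl ⟨d, hdH, a, ha, ?_⟩)
        calc x * (x * d * x * a) = (x * x) * d * x * a := by group
          _ = d * x * a := by rw [hs, one_mul]
    · rcases hy with hy | ⟨a, ha, b, hb, rfl⟩ | ⟨a, ha, rfl⟩
      · exact Or.inl (mul_mem hx hy)
      · exact Or.inr (Or.inl ⟨x * a, mul_mem hx ha, b, hb, by group⟩)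
      · refine Or.inr (Or.inr ⟨_, mul_mem (hnorm x hx) ha, ?_⟩)
        calc x * (s * d * s * a) = 1 * x * (s * d * s * a) := by group
          _ = s * d * s * (s * d * s * x * (s * d * s) * a) := by rw [← hd']; group
  · rintro x (rfl | hx)
    · exact Or.inl (inv_eq_self_of_sq hs)
    · exact Or.inr (inv_mem hx)

/-- Extending a tower along a simple edge. -/
lemma Tower.step (h : Tower K H s d) {t : G} (ht : t * t = 1) (htK : ∀ k ∈ K, t * k = k * t)
    (hbr : t * s * t = s * t * s) (hgen : H = Subgroup.closure (insert s (K : Set G))) :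
    Tower H (Subgroup.closure (insert t (H : Set G))) t (t * d * t) := by
  obtain ⟨c, hc, hdc⟩ := h.factor
  refine Tower.adjoin (T := {s}) h.le (by simpa using h.mem) h.mem' h.sq' ?_ ht htK (by simpa) ?_
  · intro g hg
    rcases h.cover g hg with hg | ⟨a, ha, b, hb, rfl⟩ | hg
    · exact Or.inl hg
    · exact Or.inr (Or.inl ⟨a, ha, s, rfl, b, hb, rfl⟩)
    · exact Or.inr (Or.inr hg)
  have hd' : t * d * t * (t * d * t) = 1 := by
    calc t * d * t * (t * d * t) = t * d * (t * t) * d * t := by group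
      _ = t * (d * d) * t := by rw [ht]; group
      _ = 1 := by rw [h.sq', mul_one, ht]
  -- Conjugation by `t d t` preserves `K`, because `t` commutes with `K`, and fixes `s`.
  suffices ∀ x ∈ insert s (K : Set G), t * d * t * x * (t * d * t) ∈ H from fun g hg =>
    conj_mem_of_mem_closure hd' this g (hgen ▸ hg)
  rintro x (rfl | hx)
  · have hfix : t * d * t * x * (t * d * t) = x := by
      have hct := htK c hc
      have e1 : t * d * t * x = x * (t * d * t) := by
        calc t * d * t * x = t * (x * c * x) * t * x := by rw [hdc]
          _ = t * x * c * (x * t * x) := by group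
          _ = t * x * c * (t * x * t) := by rw [hbr]
          _ = t * x * (c * t) * x * t := by group
          _ = (t * x * t) * c * x * t := by rw [← hct]; group
          _ = x * (t * (x * c * x) * t) := by rw [hbr]; group
          _ = x * (t * d * t) := by rw [hdc]
      rw [e1, mul_assoc, hd', mul_one]
    rw [hfix]
    exact h.mem
  · have : t * d * t * x * (t * d * t) = d * x * d := by
      have hx' := htK _ hx
      have hx'' := htK _ (h.conj_mem x hx)
      calc t * d * t * x * (t * d * t) = t * d * (t * x) * t * d * t := by group
        _ = t * d * x * (t * t) * d * t := by rw [hx']; group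
        _ = t * (d * x * d) * t := by rw [ht]; group
        _ = d * x * d * (t * t) := by rw [hx'']; group
        _ = d * x * d := by rw [ht, mul_one]
    rw [this]
    exact h.le (h.conj_mem x hx)

/-- The subgroup generated by `E` and the first `k` terms of the sequence `s`. -/
def initialSubgroup (E : Set G) (s : ℕ → G) (k : ℕ) : Subgroup G :=
  Subgroup.closure (E ∪ s '' Set.Iio k)

lemma initialSubgroup_succ (E : Set G) (s : ℕ → G) (k : ℕ) :
    initialSubgroup E s (k + 1) =
      Subgroup.closure (insert (s k) (initialSubgroup E s k : Set G)) := by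
  have hI : Set.Iio (k + 1) = insert k (Set.Iio k) := by
    ext i
    simp only [Set.mem_Iio, Set.mem_insert_iff]
    omega
  rw [initialSubgroup, initialSubgroup, hI, Set.image_insert_eq, Set.union_insert,
    Set.insert_eq, Set.insert_eq, Subgroup.closure_union,
    Subgroup.closure_union {s k}, Subgroup.closure_eq]

lemma commute_of_mem_closure {S : Set G} {t : G} (h : ∀ x ∈ S, t * x = x * t) :
    ∀ k ∈ Subgroup.closure S, t * k = k * t := by
  intro k hk
  have : Subgroup.closure S ≤ Subgroup.centralizer {t} := by
    rw [Subgroup.closure_le]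
    intro x hx
    rw [SetLike.mem_coe, Subgroup.mem_centralizer_singleton_iff]
    exact (h x hx).symm
  exact (Subgroup.mem_centralizer_singleton_iff.mp (this hk)).symm

lemma reachable_initialSubgroup [Fintype G] {E : Set G} {s : ℕ → G} {m n : ℕ} {d : G}
    (hstart : Tower (initialSubgroup E s m) (initialSubgroup E s (m + 1)) (s m) d)
    (hreach : Reachable (initialSubgroup E s m)) (hmn : m < n)
    (hsq : ∀ k < n, s k * s k = 1) (hE : ∀ k < n, m < k → ∀ x ∈ E, s k * x = x * s k)
    (hcomm : ∀ i k, k < n → m < k → i + 1 < k → s k * s i = s i * s k)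
    (hbraid : ∀ k, k + 1 < n → m ≤ k → s (k + 1) * s k * s (k + 1) = s k * s (k + 1) * s k) :
    Reachable (initialSubgroup E s n) := by
  suffices ∀ k, m ≤ k → k < n → (∃ d, Tower (initialSubgroup E s k) (initialSubgroup E s (k + 1))
      (s k) d) ∧ Reachable (initialSubgroup E s (k + 1)) by
    obtain ⟨k, rfl⟩ := Nat.exists_eq_add_of_lt hmn
    exact (this (m + k) (by omega) (by omega)).2
  intro k hmk
  induction k, hmk using Nat.le_induction with
  | base => exact fun _ => ⟨⟨d, hstart⟩, hstart.reachable hreach⟩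
  | succ k hmk ih =>
    intro hk
    obtain ⟨⟨d, hd⟩, hr⟩ := ih (by omega)
    have hstep := hd.step (hsq (k + 1) hk) ?_ (hbraid k hk hmk) (initialSubgroup_succ E s k)
    · rw [← initialSubgroup_succ] at hstep
      exact ⟨⟨_, hstep⟩, hstep.reachable hr⟩
    · refine commute_of_mem_closure ?_
      rintro x (hx | ⟨i, hi, rfl⟩)
      · exact hE _ hk (by omega) x hx
      · exact hcomm i _ hk (by omega) (by simpa using hi)

/-- Type A: consecutive involutions satisfy the braid relation, all others commute. -/
theorem reachable_typeA [Fintype G] {s : ℕ → G} {n : ℕ} (hsq : ∀ k < n, s k * s k = 1)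
    (hcomm : ∀ i k, k < n → i + 1 < k → s k * s i = s i * s k)
    (hbraid : ∀ k, k + 1 < n → s (k + 1) * s k * s (k + 1) = s k * s (k + 1) * s k) :
    Reachable (initialSubgroup ∅ s n) := by
  have h0 : initialSubgroup ∅ s 0 = ⊥ := by simp [initialSubgroup]
  rcases Nat.eq_zero_or_pos n with rfl | hn
  · rw [h0]; exact reachable_bot
  refine reachable_initialSubgroup (m := 0) (d := 1) ?_ (h0 ▸ reachable_bot) hn hsq (by simp)
    (fun i k hk _ => hcomm i k hk) (fun k hk _ => hbraid k hk)
  have := Tower.adjoin (K := ⊥) (H := ⊥) (T := ∅) (s := s 0) (d := (1 : G)) le_rfl (by simp)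
    (one_mem _) (by simp) (fun g hg => Or.inl hg) (hsq 0 hn) (by simp) (by simp)
    (by simp [hsq 0 hn])
  rw [initialSubgroup_succ, h0]
  simpa [hsq 0 hn] using this

/-- Type B: as type A, except that `s 0` and `s 1` satisfy the relation of order `4`. -/
theorem reachable_typeB [Fintype G] {s : ℕ → G} {n : ℕ} (hn : 2 ≤ n)
    (hsq : ∀ k < n, s k * s k = 1)
    (hcomm : ∀ i k, k < n → i + 1 < k → s k * s i = s i * s k)
    (hbraid : ∀ k, k + 1 < n → 1 ≤ k → s (k + 1) * s k * s (k + 1) = s k * s (k + 1) * s k)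
    (h4 : (s 1 * s 0) ^ 4 = 1) :
    Reachable (initialSubgroup ∅ s n) := by
  have h1 : initialSubgroup ∅ s 1 = Subgroup.closure {s 0} := by simp [initialSubgroup]
  have hs0 := hsq 0 (by omega)
  have hs1 := hsq 1 (by omega)
  refine reachable_initialSubgroup (m := 1) (d := s 1 * s 0 * s 1) ?_
    (h1 ▸ reachable_closure_singleton hs0) hn hsq (by simp)
    (fun i k hk _ => hcomm i k hk) hbraid
  rw [initialSubgroup_succ _ _ 1, h1]
  have hmem : s 0 ∈ Subgroup.closure {s 0} := Subgroup.subset_closure rfl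
  refine Tower.adjoin (K := ⊥) (T := ∅) bot_le (by simp) hmem hs0 ?_ hs1 (by simp) (by simp) ?_
  · intro g hg
    refine mem_of_mem_closure (C := fun g => g ∈ (⊥ : Subgroup G) ∨ _ ∨ ∃ a ∈ (⊥ : Subgroup G),
      g = s 0 * a) (Or.inl (one_mem _)) ?_ ?_ hg
    · rintro x rfl y (hy | ⟨_, _, _, h, _⟩ | ⟨a, ha, rfl⟩)
      · exact Or.inr (Or.inr ⟨y, hy, rfl⟩)
      · exact h.elim
      · exact Or.inl (by rw [← mul_assoc, hs0, one_mul]; exact ha)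
    · rintro x rfl
      exact inv_eq_self_of_sq hs0
  · set d := s 1 * s 0 * s 1 with hd
    have hd2 : d * d = 1 := by
      calc d * d = s 1 * s 0 * (s 1 * s 1) * s 0 * s 1 := by rw [hd]; group
        _ = s 1 * (s 0 * s 0) * s 1 := by rw [hs1]; group
        _ = 1 := by rw [hs0, mul_one, hs1]
    have hc : d * s 0 = s 0 * d := by
      have e1 : (d * s 0) * (d * s 0) = 1 := by
        rw [← h4, hd]
        simp only [pow_succ, pow_zero, one_mul, mul_assoc]
      have e2 := inv_eq_self_of_sq e1
      rw [← e2, mul_inv_rev, inv_eq_self_of_sq hs0, inv_eq_self_of_sq hd2]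
    intro h hh
    rw [commute_of_mem_closure (S := {s 0}) (t := d) (by simpa using hc) h hh, mul_assoc, hd2,
      mul_one]
    exact hh

/-- Type D: as type A, with one more generator `r` which commutes with all of them except `s 1`,
with which it satisfies the braid relation. -/
theorem reachable_typeD [Fintype G] {s : ℕ → G} {r : G} {n : ℕ} (hn : 2 ≤ n)
    (hsq : ∀ k < n, s k * s k = 1)
    (hcomm : ∀ i k, k < n → i + 1 < k → s k * s i = s i * s k)
    (hbraid : ∀ k, k + 1 < n → s (k + 1) * s k * s (k + 1) = s k * s (k + 1) * s k)
    (hr : r * r = 1) (hr1 : s 1 * r * s 1 = r * s 1 * r)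
    (hrcomm : ∀ k < n, k ≠ 1 → s k * r = r * s k) :
    Reachable (initialSubgroup {r} s n) := by
  have h1 : initialSubgroup {r} s 1 = Subgroup.closure {r, s 0} := by
    simp [initialSubgroup, Set.pair_comm]
  have hs0 := hsq 0 (by omega)
  have hs1 := hsq 1 (by omega)
  have hr0 := hrcomm 0 (by omega) (by omega)
  have hb0 := hbraid 0 (by omega)
  rw [zero_add] at hb0
  refine reachable_initialSubgroup (m := 1) (d := s 1 * (r * s 0) * s 1) ?_
    (h1 ▸ reachable_closure_pair hr hs0) hn hsq
    (fun k hk h1 x hx => by rw [Set.mem_singleton_iff.mp hx]; exact hrcomm k hk (by omega))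
    (fun i k hk _ => hcomm i k hk) (fun k hk _ => hbraid k hk)
  rw [initialSubgroup_succ _ _ 1, h1]
  have hmr : r ∈ Subgroup.closure {r, s 0} := Subgroup.subset_closure (by simp)
  have hms : s 0 ∈ Subgroup.closure {r, s 0} := Subgroup.subset_closure (by simp)
  have hd2 : r * s 0 * (r * s 0) = 1 := by
    calc r * s 0 * (r * s 0) = r * (s 0 * r) * s 0 := by group
      _ = (r * r) * (s 0 * s 0) := by rw [hr0]; group
      _ = 1 := by rw [hr, hs0, one_mul]
  refine Tower.adjoin (K := ⊥) (T := {r, s 0}) bot_le Subgroup.subset_closure (mul_mem hmr hms)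
    hd2 ?_ hs1 (by simp) ?_ ?_
  · intro g hg
    suffices g = 1 ∨ g = r ∨ g = s 0 ∨ g = r * s 0 by
      rcases this with rfl | rfl | rfl | rfl
      · exact Or.inl (one_mem _)
      · exact Or.inr (Or.inl ⟨1, one_mem _, g, by simp, 1, one_mem _, by group⟩)
      · exact Or.inr (Or.inl ⟨1, one_mem _, s 0, by simp, 1, one_mem _, by group⟩)
      · exact Or.inr (Or.inr ⟨1, one_mem _, by group⟩)
    refine mem_of_mem_closure (C := fun g => g = 1 ∨ g = r ∨ g = s 0 ∨ g = r * s 0)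
      (Or.inl rfl) ?_ ?_ hg
    · rintro x (rfl | rfl) y (rfl | rfl | rfl | rfl)
      · simp
      · simp [hr]
      · simp
      · simp [← mul_assoc, hr]
      · simp
      · simp [hr0]
      · simp [hs0]
      · rw [← mul_assoc, hr0, mul_assoc, hs0]; simp
    · rintro x (rfl | rfl)
      · simp [inv_eq_self_of_sq hr]
      · simp [inv_eq_self_of_sq hs0]
  · rintro t (rfl | rfl)
    · exact hr1
    · exact hb0
  · set d := s 1 * (r * s 0) * s 1 with hd
    have hd3 : d * d = 1 := by
      calc d * d = s 1 * (r * s 0) * (s 1 * s 1) * (r * s 0) * s 1 := by rw [hd]; group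
        _ = s 1 * (r * s 0 * (r * s 0)) * s 1 := by rw [hs1]; group
        _ = 1 := by rw [hd2, mul_one, hs1]
    -- Conjugation by `d` interchanges `r` and `s 0`.
    have e0 : d * s 0 = r * d := by
      calc d * s 0 = s 1 * r * (s 0 * s 1 * s 0) := by rw [hd]; group
        _ = s 1 * r * s 1 * s 0 * s 1 := by rw [← hb0]; group
        _ = r * d := by rw [hr1, hd]; group
    have e1 : d * r * d = s 0 := by
      have : r = d * s 0 * d := by rw [e0, mul_assoc, hd3, mul_one]
      calc d * r * d = (d * d) * s 0 * (d * d) := by rw [this]; group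
        _ = s 0 := by rw [hd3]; group
    have e2 : d * s 0 * d = r := by rw [e0, mul_assoc, hd3, mul_one]
    refine conj_mem_of_mem_closure hd3 ?_
    rintro x (rfl | rfl)
    · rw [e1]
      exact hms
    · rw [e2]
      exact hmr

end Towers

end Mixing

namespace Mixing

/-! ### Coset enumeration and the exceptional types F, H -/

section CosetTables

/-- The entry of a coset table: the number of the coset obtained from the coset number `k` by the
generator number `i`. -/
def entry (t : List (List ℕ)) (i k : ℕ) : ℕ := (t.getD k []).getD i 0

/-- The result of applying the generators of the word `w` to the coset number `k`, the last letter
first. -/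
def walk (t : List (List ℕ)) (w : List ℕ) (k : ℕ) : ℕ := w.foldr (entry t) k

/-- The generator among `0, …, n` leading from `k` to the smallest number. -/
def parent (t : List (List ℕ)) (n k : ℕ) : ℕ :=
  ((List.range (n + 1)).find? fun i =>
    (List.range (n + 1)).all fun j => Nat.ble (entry t i k) (entry t j k)).getD 0

/-- A word leading from `0` to `k`, obtained by going from each coset to its parent
(`f` bounds the length). -/
def wordTo (t : List (List ℕ)) (n : ℕ) : ℕ → ℕ → List ℕ
  | 0, _ => []
  | f + 1, k =>
    match k with
    | 0 => []
    | k + 1 => parent t n (k + 1) :: wordTo t n f (entry t (parent t n (k + 1)) (k + 1))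

/-- Starting from `k`, go to smaller numbers by the generators `0, …, n - 1` as long as possible
(`f` bounds the number of steps). -/
def descend (t : List (List ℕ)) (n : ℕ) : ℕ → ℕ → ℕ
  | 0, k => k
  | f + 1, k =>
    match (List.range n).find? fun i => Nat.blt (entry t i k) k with
    | none => k
    | some i => descend t n f (entry t i k)

/-- Apply `i` and then `j` to `u`, `c` times over, as long as only rows with number below `k` are
needed. -/
def alternate (t : List (List ℕ)) (i j k : ℕ) : ℕ → ℕ → Option ℕ
  | 0, u => some u
  | c + 1, u =>
    if Nat.blt u k && Nat.blt (entry t i u) k then alternate t i j k c (entry t j (entry t i u))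
    else none

/-- The entry of the table at `i`, `k` follows from the rows before the `k`-th one: as the inverse
of an edge in one of them, by the definition of a new coset, or from the relation between the
generators `i` and `j` for some `j`. -/
def entryOk (m : ℕ → ℕ → ℕ) (t : List (List ℕ)) (n i k : ℕ) : Bool :=
  (Nat.blt (entry t i k) k && Nat.beq (entry t i (entry t i k)) k) ||
  (Nat.blt k (entry t i k) && Nat.beq (parent t n (entry t i k)) i &&
    Nat.beq (entry t i (entry t i k)) k) ||
  (List.range (n + 1)).any fun j =>
    Nat.blt (entry t j k) k && Nat.beq (entry t j (entry t j k)) k &&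
      (alternate t i j k (m i j - 1) (entry t j k) == some (entry t i k))

/-- The rows of the table are numbered so that each entry follows from the previous rows, and
every double coset is closed under inversion. -/
def tableOk (m : ℕ → ℕ → ℕ) (t : List (List ℕ)) (n N : ℕ) : Bool :=
  (List.range n).all (fun i => Nat.beq (entry t i 0) 0) &&
  (Nat.beq (entry t n 0) 1) && (Nat.beq (parent t n 1) n) && (Nat.beq (entry t n 1) 0) &&
  (List.range N).all (fun k => (List.range (n + 1)).all fun i =>
    Nat.blt (entry t i k) N && (Nat.beq k 0 || entryOk m t n i k)) &&
  (List.range N).all (fun k =>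
    ((List.range n).any fun i => Nat.blt (entry t i k) k && Nat.beq (entry t i (entry t i k)) k) ||
    (Nat.beq (walk t (wordTo t n N k) 0) k && (wordTo t n N k).all (fun i => Nat.ble i n) &&
      Nat.beq (descend t n N (walk t (wordTo t n N k).reverse 0)) k))

variable {G : Type*} [Group G]

/-- The coset with number `k`, reached from its parent. -/
noncomputable def cosetAt (t : List (List ℕ)) (n : ℕ) (s : ℕ → G) (K : Subgroup G) (k : ℕ) :
    G ⧸ K :=
  if entry t (parent t n k) k < k then
    s (parent t n k) • cosetAt t n s K (entry t (parent t n k) k)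
  else ((1 : G) : G ⧸ K)
termination_by k

variable {m : ℕ → ℕ → ℕ} {t : List (List ℕ)} {n N : ℕ} {s : ℕ → G} {K : Subgroup G}

lemma alternate_sound {i j k : ℕ} {x : ℕ → G ⧸ K}
    (hrow : ∀ l < k, s i • x l = x (entry t i l) ∧ s j • x l = x (entry t j l)) (c : ℕ) :
    ∀ u v, alternate t i j k c u = some v → (s j * s i) ^ c • x u = x v := by
  induction c with
  | zero =>
    intro u v h
    simp only [alternate, Option.some.injEq] at h
    simp [h]
  | succ c ih =>
    intro u v h
    simp only [alternate, Bool.and_eq_true, Nat.blt_eq] at h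
    split_ifs at h with hu
    rw [pow_succ, mul_smul, mul_smul, (hrow u hu.1).1, (hrow _ hu.2).2]
    exact ih _ _ h

/-- The generators permute the numbered cosets as the table says. -/
lemma smul_cosetAt (hok : tableOk m t n N = true) (hsq : ∀ i ≤ n, s i * s i = 1)
    (hrel : ∀ i ≤ n, ∀ j ≤ n, (s i * s j) ^ m i j = 1) (hm : ∀ i j, 0 < m i j)
    (hK : ∀ i < n, s i ∈ K) (k : ℕ) :
    k < N → ∀ i ≤ n, s i • cosetAt t n s K k = cosetAt t n s K (entry t i k) := by
  simp only [tableOk, Bool.and_eq_true, List.all_eq_true, List.mem_range, Nat.blt_eq,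
    Nat.beq_eq, Bool.or_eq_true, Nat.lt_add_one_iff] at hok
  obtain ⟨⟨⟨⟨⟨h00, h01⟩, hp1⟩, h10⟩, hrows⟩, -⟩ := hok
  induction k using Nat.strong_induction_on with
  | _ k ih =>
  intro hk i hi
  have hzero : cosetAt t n s K 0 = ((1 : G) : G ⧸ K) := by
    rw [cosetAt, if_neg (Nat.not_lt_zero _)]
  rcases Nat.eq_zero_or_pos k with rfl | hkpos
  · rcases hi.lt_or_eq with hi | rfl
    · rw [h00 i hi, hzero, MulAction.Quotient.smul_coe, smul_eq_mul, mul_one, QuotientGroup.eq,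
        mul_one]
      exact inv_mem (hK i hi)
    · rw [h01]
      conv_rhs => rw [cosetAt, hp1, h10, if_pos Nat.one_pos]
  have hrow : ∀ l < k, ∀ i ≤ n, s i • cosetAt t n s K l = cosetAt t n s K (entry t i l) :=
    fun l hl => ih l hl (hl.trans hk)
  have hup : ∀ j ≤ n, entry t j k < k → entry t j (entry t j k) = k →
      s j • cosetAt t n s K k = cosetAt t n s K (entry t j k) := by
    intro j hj h1 h2
    have := hrow _ h1 j hj
    rw [h2] at this
    rw [← this, ← mul_smul, hsq j hj, one_smul]
  have hcase := (hrows k hk i hi).2.resolve_left hkpos.ne'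
  simp only [entryOk, Bool.and_eq_true, List.any_eq_true, List.mem_range, Nat.blt_eq,
    Nat.beq_eq, Bool.or_eq_true, Nat.lt_add_one_iff, beq_iff_eq] at hcase
  rcases hcase with (⟨h1, h2⟩ | ⟨⟨h1, h2⟩, h3⟩) | ⟨j, hj, ⟨h1, h2⟩, h3⟩
  · exact hup i hi h1 h2
  · conv_rhs => rw [cosetAt, h2, h3, if_pos h1]
  · have h4 := alternate_sound (fun l hl => ⟨hrow l hl i hi, hrow l hl j hj⟩) _ _ _ h3
    rw [← hup j hj h1 h2] at h4
    rw [← h4, ← mul_smul]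
    congr 1
    -- The relation of order `m i j` expresses `s i` by the remaining letters.
    have h5 := hrel i hi j hj
    obtain ⟨c, hc⟩ := Nat.exists_eq_add_of_lt (hm i j)
    rw [hc, zero_add, pow_succ', mul_assoc] at h5
    have h6 := inv_eq_of_mul_eq_one_right h5
    rw [inv_eq_self_of_sq (hsq i hi)] at h6
    rw [hc, zero_add, Nat.add_sub_cancel, mul_pow_mul, ← h6]

/-- A valid coset table for the subgroup generated by all generators but the last one shows that
every double coset is closed under inversion. -/
theorem reachable_of_tableOk [Fintype G] (hok : tableOk m t n N = true) (hN : 0 < N)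
    (hsq : ∀ i ≤ n, s i * s i = 1)
    (hrel : ∀ i ≤ n, ∀ j ≤ n, (s i * s j) ^ m i j = 1) (hm : ∀ i j, 0 < m i j)
    (hreach : Reachable (initialSubgroup ∅ s n)) :
    Reachable (initialSubgroup ∅ s (n + 1)) := by
  set K := initialSubgroup ∅ s n with hKdef
  have hK : ∀ i < n, s i ∈ K := fun i hi =>
    Subgroup.subset_closure (Or.inr ⟨i, hi, rfl⟩)
  have hsmul := smul_cosetAt hok hsq hrel hm hK
  simp only [tableOk, Bool.and_eq_true, List.all_eq_true, List.mem_range, Nat.blt_eq,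
    Nat.beq_eq, Bool.or_eq_true, Nat.lt_add_one_iff, List.any_eq_true] at hok
  obtain ⟨⟨-, hrows⟩, hinv⟩ := hok
  set x := cosetAt t n s K with hx
  have hzero : x 0 = ((1 : G) : G ⧸ K) := by
    rw [hx, cosetAt, if_neg (Nat.not_lt_zero _)]
  have hwalk : ∀ w : List ℕ, (∀ i ∈ w, i ≤ n) →
      walk t w 0 < N ∧ (((w.map s).prod : G) : G ⧸ K) = x (walk t w 0) := by
    intro w
    induction w with
    | nil => exact fun _ => ⟨hN, by simp [walk, hzero]⟩
    | cons i w ih =>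
      intro hw
      obtain ⟨h1, h2⟩ := ih fun j hj => hw j (List.mem_cons_of_mem _ hj)
      have hi := hw i List.mem_cons_self
      refine ⟨(hrows _ h1 i hi).1, ?_⟩
      rw [List.map_cons, List.prod_cons, ← smul_eq_mul, ← MulAction.Quotient.smul_coe, h2,
        hsmul _ h1 i hi]
      rfl
  have hdesc : ∀ f k, k < N → ∃ a ∈ K, a • x (descend t n f k) = x k := by
    intro f
    induction f with
    | zero => exact fun k _ => ⟨1, one_mem _, one_smul _ _⟩
    | succ f ih =>
      intro k hk
      rw [descend]
      split
      · exact ⟨1, one_mem _, one_smul _ _⟩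
      · rename_i i hi
        have hin : i < n := List.mem_range.mp (List.mem_of_find?_eq_some hi)
        obtain ⟨a, ha, h⟩ := ih (entry t i k) (hrows k hk i hin.le).1
        refine ⟨s i * a, mul_mem (hK i hin) ha, ?_⟩
        rw [mul_smul, h, ← hsmul k hk i hin.le, ← mul_smul, hsq i hin.le, one_smul]
  -- Each numbered coset lies in a double coset closed under inversion.
  have hself : ∀ k < N, ∃ g : G, (g : G ⧸ K) = x k ∧ ∃ a ∈ K, ∃ b ∈ K, g⁻¹ = a * g * b := by
    intro k
    induction k using Nat.strong_induction_on with
    | _ k ih =>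
    intro hk
    rcases hinv k hk with ⟨i, hi, h1, h2⟩ | ⟨⟨h1, h2⟩, h3⟩
    · obtain ⟨g, hg, a, ha, b, hb, e⟩ := ih _ h1 (h1.trans hk)
      refine ⟨s i * g, ?_, a * s i, mul_mem ha (hK i hi), b * s i, mul_mem hb (hK i hi), ?_⟩
      · rw [← smul_eq_mul, ← MulAction.Quotient.smul_coe, hg, hsmul _ (h1.trans hk) i hi.le, h2]
      · rw [mul_inv_rev, e, inv_eq_self_of_sq (hsq i hi.le)]
        calc a * g * b * s i = a * 1 * g * b * s i := by group
          _ = a * s i * (s i * g) * (b * s i) := by rw [← hsq i hi.le]; group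
    · set w := wordTo t n N k
      have hw : ∀ i ∈ w, i ≤ n := fun i hi => by simpa using h2 i hi
      have hrev : ((w.reverse.map s).prod : G) = ((w.map s).prod)⁻¹ := by
        rw [List.prod_inv_reverse, ← List.map_reverse, ← List.map_reverse, List.map_map]
        congr 1
        refine List.map_congr_left fun i hi => ?_
        exact (inv_eq_self_of_sq (hsq i (hw i (List.mem_reverse.mp hi)))).symm
      refine ⟨(w.map s).prod, by rw [(hwalk w hw).2, h1], ?_⟩
      obtain ⟨h4, h5⟩ := hwalk w.reverse (fun i hi => hw i (List.mem_reverse.mp hi))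
      obtain ⟨a, ha, h6⟩ := hdesc N _ h4
      rw [h3, ← h5, hrev, ← h1, ← (hwalk w hw).2, MulAction.Quotient.smul_coe, smul_eq_mul,
        QuotientGroup.eq] at h6
      exact ⟨a, ha, _, h6, by group⟩
  refine Reachable.of_inv_mem_doubleCoset (K := K) ?_ ?_ hreach
  · exact Subgroup.closure_mono (Set.union_subset_union_right _
      (Set.image_mono (Set.Iio_subset_Iio n.le_succ)))
  intro h hh
  obtain ⟨k, hk, e⟩ : ∃ k < N, (h : G ⧸ K) = x k := by
    refine mem_of_mem_closure (C := fun h : G => ∃ k < N, (h : G ⧸ K) = x k) ⟨0, hN, hzero.symm⟩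
      ?_ ?_ hh
    · rintro _ (hF | ⟨i, hi, rfl⟩) y ⟨k, hk, e⟩
      · exact hF.elim
      · have hi' : i ≤ n := Nat.lt_succ_iff.mp hi
        exact ⟨_, (hrows k hk i hi').1, by
          rw [← smul_eq_mul, ← MulAction.Quotient.smul_coe, e, hsmul k hk i hi']⟩
    · rintro _ (hF | ⟨i, hi, rfl⟩)
      · exact hF.elim
      · exact Or.inr ⟨i, hi, (inv_eq_self_of_sq (hsq i (Nat.lt_succ_iff.mp hi))).symm⟩
  obtain ⟨g, hg, a, ha, b, hb, e'⟩ := hself k hk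
  rw [← e, QuotientGroup.eq] at hg
  set c := g⁻¹ * h with hc
  have hh' : h = g * c := by rw [hc]; group
  refine ⟨c⁻¹ * a, mul_mem (inv_mem hg) ha, c⁻¹ * b, mul_mem (inv_mem hg) hb, ?_⟩
  rw [hh', mul_inv_rev, e']
  group

/-- The orders of the products of two generators for a diagram which is a path with labels `w`. -/
def pathOrder (w : List ℕ) (i j : ℕ) : ℕ :=
  if i = j then 1 else if i + 1 = j then w.getD i 2 else if j + 1 = i then w.getD j 2 else 2

/-- The cosets of `I₂(5)` in `H₃`. -/
def tableH₃ : List (List ℕ) :=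
   [[0, 0, 1], [1, 2, 0], [3, 1, 2], [2, 4, 3], [5, 3, 6], [4, 5, 7], [7, 6, 4], [6, 8, 5], [9,
    7, 8], [8, 10, 9], [10, 9, 11], [11, 11, 10]]

/-- The cosets of `B₃` in `F₄`. -/
def tableF₄ : List (List ℕ) :=
   [[0, 0, 0, 1], [1, 1, 2, 0], [2, 3, 1, 2], [4, 2, 5, 3], [3, 4, 6, 4], [6, 5, 3, 7], [5, 8,
    4, 9], [9, 7, 7, 5], [8, 6, 10, 11], [7, 11, 9, 6], [10, 10, 8, 12], [11, 9, 13, 8], [12,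
    12, 14, 10], [13, 15, 11, 14], [14, 16, 12, 13], [17, 13, 15, 16], [18, 14, 19, 15], [15,
    17, 17, 18], [16, 18, 20, 17], [20, 19, 16, 19], [19, 21, 18, 20], [21, 20, 22, 21], [22,
    22, 21, 23], [23, 23, 23, 22]]

/-- The cosets of `H₃` in `H₄`. -/
def tableH₄ : List (List ℕ) :=
   [[0, 0, 0, 1], [1, 1, 2, 0], [2, 3, 1, 2], [4, 2, 3, 3], [3, 5, 4, 4], [6, 4, 7, 5], [5, 6,
    8, 6], [8, 7, 5, 9], [7, 10, 6, 11], [11, 9, 9, 7], [12, 8, 10, 13], [9, 13, 11, 8], [10,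
    14, 12, 15], [15, 11, 16, 10], [14, 12, 17, 18], [13, 18, 19, 12], [19, 16, 13, 16], [17,
    17, 14, 20], [18, 15, 21, 14], [16, 22, 15, 19], [20, 20, 23, 17], [21, 24, 18, 23], [25,
    19, 24, 22], [23, 26, 20, 21], [27, 21, 22, 26], [22, 28, 27, 25], [29, 23, 26, 24], [24,
    30, 25, 29], [28, 25, 31, 28], [26, 32, 29, 27], [33, 27, 34, 32], [31, 34, 28, 35], [36,
    29, 37, 30], [30, 33, 38, 36], [38, 31, 30, 39], [35, 39, 35, 31], [32, 36, 40, 33], [40,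
    37, 32, 41], [34, 42, 33, 43], [43, 35, 41, 34], [37, 44, 36, 45], [45, 41, 39, 37], [46,
    38, 42, 47], [39, 47, 45, 38], [48, 40, 44, 49], [41, 49, 43, 40], [42, 46, 46, 50], [50,
    43, 51, 42], [44, 52, 48, 53], [53, 45, 54, 44], [47, 50, 55, 46], [55, 54, 47, 51], [52,
    48, 56, 57], [49, 57, 58, 48], [58, 51, 49, 54], [51, 59, 50, 55], [56, 56, 52, 60], [57,
    53, 61, 52], [54, 62, 53, 58], [63, 55, 59, 59], [60, 60, 64, 56], [61, 65, 57, 64], [66,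
    58, 65, 62], [59, 67, 63, 63], [64, 68, 60, 61], [69, 61, 62, 68], [62, 70, 69, 66], [70,
    63, 71, 67], [72, 64, 68, 65], [65, 73, 66, 72], [67, 66, 74, 70], [74, 71, 67, 75], [68,
    76, 72, 69], [77, 69, 78, 76], [71, 78, 70, 79], [79, 75, 75, 71], [80, 72, 81, 73], [73,
    77, 82, 80], [82, 74, 73, 83], [75, 83, 79, 74], [76, 80, 84, 77], [84, 81, 76, 85], [78,
    86, 77, 87], [87, 79, 85, 78], [81, 88, 80, 89], [89, 85, 83, 81], [86, 82, 86, 90], [83,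
    90, 89, 82], [91, 84, 88, 92], [85, 92, 87, 84], [90, 87, 93, 86], [88, 94, 91, 95], [95,
    89, 96, 88], [93, 96, 90, 93], [94, 91, 97, 98], [92, 98, 99, 91], [99, 93, 92, 96], [97,
    97, 94, 100], [98, 95, 101, 94], [96, 102, 95, 99], [100, 100, 103, 97], [101, 104, 98,
    103], [105, 99, 104, 102], [103, 106, 100, 101], [107, 101, 102, 106], [102, 105, 107, 105],
    [108, 103, 106, 104], [104, 109, 105, 108], [106, 110, 108, 107], [111, 107, 109, 110],
    [112, 108, 113, 109], [109, 111, 111, 112], [110, 112, 114, 111], [114, 113, 110, 113],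
    [113, 115, 112, 114], [116, 114, 115, 115], [115, 117, 116, 116], [117, 116, 118, 117],
    [118, 118, 117, 119], [119, 119, 119, 118]]

lemma tableOk_H₃ : tableOk (pathOrder [5, 3]) tableH₃ 2 12 = true := by decide +kernel

lemma tableOk_F₄ : tableOk (pathOrder [3, 4, 3]) tableF₄ 3 24 = true := by decide +kernel

lemma tableOk_H₄ : tableOk (pathOrder [5, 3, 3]) tableH₄ 3 120 = true := by decide +kernel

end CosetTables

end Mixing

namespace Mixing

/-! ### Positive definiteness of the canonical bilinear form -/

section Form

open Module Polynomial.Chebyshev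

variable {B : Type*} (M : CoxeterMatrix B)

/-- The Gram matrix `-cos (π / m i j)`. The value `m i j = 0`, which encodes `∞`, gives the
customary entry `-1`. -/
noncomputable def gram (i j : B) : ℝ := -Real.cos (Real.pi / M i j)

lemma gram_symm (i j : B) : gram M i j = gram M j i := by rw [gram, gram, M.symmetric]

lemma gram_self (i : B) : gram M i i = 1 := by simp [gram]

variable {M} in
lemma gram_nonpos {i j : B} (h : i ≠ j) : gram M i j ≤ 0 := by
  rw [gram, neg_nonpos]
  have h1 := M.off_diagonal i j h
  rcases Nat.eq_zero_or_pos (M i j) with h0 | hpos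
  · rw [h0]; simp
  have h2 : (2 : ℝ) ≤ M i j := by exact_mod_cast (by omega : 2 ≤ M i j)
  refine Real.cos_nonneg_of_neg_pi_div_two_le_of_le ?_ ?_
  · have : 0 ≤ Real.pi / M i j := by positivity
    linarith [Real.pi_pos]
  · exact div_le_div_of_nonneg_left Real.pi_pos.le two_pos h2

variable {M} in
lemma gram_le_neg_cos {i j : B} {m : ℕ} (hm : 1 ≤ m) (h : m ≤ M i j ∨ M i j = 0) :
    gram M i j ≤ -Real.cos (Real.pi / m) := by
  rw [gram, neg_le_neg_iff]
  have hmR : (1 : ℝ) ≤ m := by exact_mod_cast hm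
  rcases h with h | h
  · refine Real.cos_le_cos_of_nonneg_of_le_pi (by positivity) ?_ ?_
    · exact div_le_self Real.pi_pos.le hmR
    · exact div_le_div_of_nonneg_left Real.pi_pos.le (by positivity) (by exact_mod_cast h)
  · rw [h]
    simpa using Real.cos_le_one _

variable {M} in
lemma gram_le_neg_half {i j : B} (h : (coxeterDiagram M).Adj i j) : gram M i j ≤ -(1 / 2) := by
  have := gram_le_neg_cos (M := M) (i := i) (j := j) (m := 3) (by norm_num) h.2
  rwa [Nat.cast_ofNat, Real.cos_pi_div_three] at this

variable [Fintype B] [DecidableEq B]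

/-- The canonical bilinear form of a Coxeter matrix. -/
noncomputable def form : LinearMap.BilinForm ℝ (B → ℝ) := Matrix.toBilin' (Matrix.of (gram M))

lemma form_single (i j : B) : form M (Pi.single i 1) (Pi.single j 1) = gram M i j := by
  simp [form, Matrix.toBilin'_single]

lemma form_apply (x y : B → ℝ) : form M x y = ∑ i, ∑ j, x i * gram M i j * y j := by
  simp [form, Matrix.toBilin'_apply]

lemma form_symm (x y : B → ℝ) : form M x y = form M y x := by
  rw [form_apply, form_apply, Finset.sum_comm]
  refine Finset.sum_congr rfl fun i _ => Finset.sum_congr rfl fun j _ => ?_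
  rw [gram_symm M j i]
  ring

/-- The linear functional `x ↦ 2 ⟨e_i, x⟩`. -/
noncomputable def coroot (i : B) : Dual ℝ (B → ℝ) := (2 : ℝ) • form M (Pi.single i 1)

lemma coroot_apply (i : B) (x : B → ℝ) : coroot M i x = 2 * form M (Pi.single i 1) x := rfl

lemma coroot_single (i j : B) : coroot M i (Pi.single j 1) = 2 * gram M i j := by
  rw [coroot_apply, form_single]

lemma coroot_self (i : B) : coroot M i (Pi.single i 1) = 2 := by
  rw [coroot_single, gram_self, mul_one]

/-- The reflections of the geometric representation satisfy the Coxeter relations. -/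
lemma reflection_isLiftable : M.IsLiftable fun i => reflection (coroot_self M i) := by
  intro i j
  change (reflection (coroot_self M i) * reflection (coroot_self M j)) ^ M i j = 1
  rcases eq_or_ne i j with rfl | hij
  · rw [M.diagonal, pow_one]
    ext1 x
    exact involutive_reflection (coroot_self M i) x
  rcases Nat.eq_zero_or_pos (M i j) with h0 | hpos
  · rw [h0, pow_zero]
  have h1 := M.off_diagonal i j hij
  ext1 z
  rw [reflection_mul_reflection_pow_apply (coroot_self M i) (coroot_self M j) (M i j) z]
  set m := M i j with hm
  set t := coroot M i (Pi.single j 1) * coroot M j (Pi.single i 1) - 2 with ht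
  have ht' : t = 2 * Real.cos (2 * (Real.pi / m)) := by
    rw [ht, coroot_single, coroot_single, gram_symm M j i, gram, ← hm, Real.cos_two_mul]
    ring
  rcases eq_or_ne m 2 with h2 | h2
  · -- Orthogonal roots.
    have hg : gram M i j = 0 := by rw [gram, ← hm, h2]; simp
    have e1 : coroot M i (Pi.single j 1) = 0 := by rw [coroot_single, hg, mul_zero]
    have e2 : coroot M j (Pi.single i 1) = 0 := by rw [coroot_single, gram_symm, hg, mul_zero]
    have hm2 : ((m : ℤ) - 2) / 2 = 0 ∧ ((m : ℤ) - 1) / 2 = 0 ∧ ((m : ℤ) - 3) / 2 = -1 ∧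
      (m : ℤ) / 2 = 1 := by omega
    rw [hm2.1, hm2.2.1, hm2.2.2.1, hm2.2.2.2, ht, e1, e2]
    simp only [S_zero, S_one, S_neg_one, Polynomial.eval_one, Polynomial.eval_X,
      Polynomial.eval_zero, LinearEquiv.coe_one, id_eq]
    module
  set θ := 2 * (Real.pi / m) with hθ
  have hm3 : 3 ≤ m := by omega
  have hmR : (3 : ℝ) ≤ m := by exact_mod_cast hm3
  have hsin : Real.sin θ ≠ 0 := by
    refine (Real.sin_pos_of_pos_of_lt_pi (by rw [hθ]; positivity) ?_).ne'
    rw [hθ, ← mul_div_assoc, div_lt_iff₀ (by positivity)]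
    nlinarith [Real.pi_pos]
  have hS : ∀ k : ℤ, (S ℝ k).eval t * Real.sin θ = Real.sin ((k + 1) * θ) := fun k => by
    rw [ht', S_two_mul_real_cos]
  have hmθ : (m : ℝ) * θ = 2 * Real.pi := by
    rw [hθ]
    field_simp
  obtain ⟨k, hk⟩ := Nat.even_or_odd' m
  rcases hk with hk | hk
  · have hz : (S ℝ (k - 1)).eval t = 0 := by
      have h := hS (k - 1)
      have : ((k - 1 : ℤ) + 1 : ℝ) * θ = Real.pi := by
        rw [hk] at hmθ
        push_cast at hmθ ⊢
        linarith
      rw [this, Real.sin_pi] at h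
      exact (mul_eq_zero.mp h).resolve_right hsin
    have hm2 : ((m : ℤ) - 2) / 2 = k - 1 ∧ ((m : ℤ) - 1) / 2 = k - 1 := by omega
    rw [hm2.1, hm2.2, hz]
    simp
  · have hz : (S ℝ k).eval t + (S ℝ (k - 1)).eval t = 0 := by
      have h := hS k
      have h' := hS (k - 1)
      have : ((k : ℤ) + 1 : ℝ) * θ = 2 * Real.pi - ((k - 1 : ℤ) + 1 : ℝ) * θ := by
        rw [hk] at hmθ
        push_cast at hmθ ⊢
        linarith
      rw [this, Real.sin_two_pi_sub] at h
      refine (mul_eq_zero.mp (?_ : _ * Real.sin θ = 0)).resolve_right hsin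
      rw [add_mul, h, h']
      ring
    have hm2 : ((m : ℤ) - 2) / 2 = k - 1 ∧ ((m : ℤ) - 1) / 2 = k ∧ ((m : ℤ) - 3) / 2 = k - 1 ∧
      (m : ℤ) / 2 = k := by omega
    rw [hm2.1, hm2.2.1, hm2.2.2.1, hm2.2.2.2, hz]
    simp

variable {M}

/-- Averaging the standard scalar product over a finite Coxeter group with connected diagram gives a
positive multiple of the canonical form, which is therefore positive definite. -/
theorem form_pos {G : Type*} [Group G] [Fintype G] (cs : CoxeterSystem M G)
    (hirr : IsIrreducible M) {x : B → ℝ} (hx : x ≠ 0) : 0 < form M x x := by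
  set ρ : G →* ((B → ℝ) ≃ₗ[ℝ] (B → ℝ)) := cs.lift ⟨_, reflection_isLiftable M⟩ with hρ
  have hρs : ∀ i x, ρ (cs.simple i) x = x - coroot M i x • Pi.single i 1 := by
    intro i x
    rw [hρ, cs.lift_apply_simple (reflection_isLiftable M) i, reflection_apply]
  set I : LinearMap.BilinForm ℝ (B → ℝ) :=
    ∑ g : G, (Matrix.toBilin' (1 : Matrix B B ℝ)).comp (ρ g).toLinearMap (ρ g).toLinearMap with hI
  have hIapply : ∀ x y, I x y = ∑ g : G, ∑ b, ρ g x b * ρ g y b := by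
    intro x y
    simp [hI, LinearMap.sum_apply, Matrix.toBilin'_apply, Matrix.one_apply]
  have hIsymm : ∀ x y, I x y = I y x := fun x y => by
    simp only [hIapply, mul_comm]
  have hIinv : ∀ g x y, I (ρ g x) (ρ g y) = I x y := by
    intro g x y
    rw [hIapply, hIapply]
    refine Fintype.sum_equiv (Equiv.mulRight g) _ _ fun h => ?_
    simp
  have hIpos : ∀ x, x ≠ 0 → 0 < I x x := by
    intro x hx
    rw [hIapply]
    refine Finset.sum_pos' (fun g _ => Finset.sum_nonneg fun b _ => mul_self_nonneg _)
      ⟨1, Finset.mem_univ _, ?_⟩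
    obtain ⟨b, hb⟩ := Function.ne_iff.mp hx
    refine Finset.sum_pos' (fun b _ => mul_self_nonneg _) ⟨b, Finset.mem_univ _, ?_⟩
    rw [map_one]
    exact mul_self_pos.mpr hb
  have hne : ∀ i : B, (Pi.single i 1 : B → ℝ) ≠ 0 := fun i => by simp
  -- The simple reflections are orthogonal for `I`.
  have key : ∀ i y, I (Pi.single i 1) y
      = form M (Pi.single i 1) y * I (Pi.single i 1) (Pi.single i 1) := by
    intro i y
    have h1 := hIinv (cs.simple i) (Pi.single i 1) y
    rw [hρs, hρs, coroot_self, coroot_apply] at h1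
    simp only [map_sub, map_smul, LinearMap.sub_apply, LinearMap.smul_apply, smul_eq_mul] at h1
    linarith
  have hadj : ∀ i j, (coxeterDiagram M).Adj i j →
      I (Pi.single i 1) (Pi.single i 1) = I (Pi.single j 1) (Pi.single j 1) := by
    intro i j hij
    have h1 := key i (Pi.single j 1)
    have h2 := key j (Pi.single i 1)
    rw [hIsymm, h1, form_single, form_single, gram_symm M j i] at h2
    have h3 := gram_le_neg_half hij
    exact mul_left_cancel₀ (by linarith) h2
  obtain ⟨i₀⟩ := hirr.nonempty
  set C := I (Pi.single i₀ 1) (Pi.single i₀ 1) with hC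
  have hconst : ∀ i, I (Pi.single i 1) (Pi.single i 1) = C := by
    intro i
    obtain ⟨p⟩ := hirr.preconnected i i₀
    induction p with
    | nil => rfl
    | cons h _ ih => exact (hadj _ _ h).trans (ih rfl)
  have hIform : I = C • form M := by
    refine LinearMap.pi_ext' fun i => LinearMap.ext_ring (LinearMap.ext fun y => ?_)
    have := key i y
    rw [hconst] at this
    simpa [mul_comm] using this
  have h1 := hIpos x hx
  have h2 : 0 < C := hIpos _ (hne i₀)
  rw [hIform] at h1
  simp only [LinearMap.smul_apply, smul_eq_mul] at h1
  exact (mul_pos_iff_of_pos_left h2).mp h1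

end Form

end Mixing

namespace Mixing

/-! ### Test vectors -/

section TestVectors

variable {B : Type*} [Fintype B] [DecidableEq B] {M : CoxeterMatrix B}

/-- Positive definiteness of the canonical form. -/
def PosDefinite (M : CoxeterMatrix B) : Prop := ∀ x : B → ℝ, x ≠ 0 → 0 < form M x x

lemma form_single_left (p : B) (x : B → ℝ) :
    form M (Pi.single p 1) x = ∑ b, gram M p b * x b := by
  simp [form_apply, Pi.single_apply, Finset.sum_ite_eq']

/-- Only nonpositive terms are dropped when the value at a vertex outside the support is estimated
by the contribution of some of the vertices. -/
lemma form_single_le_sum {x : B → ℝ} (hx : ∀ b, 0 ≤ x b) {p : B} (hp : x p = 0) (T : Finset B) :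
    form M (Pi.single p 1) x ≤ ∑ q ∈ T, gram M p q * x q := by
  rw [form_single_left, ← Finset.sum_add_sum_compl T]
  refine add_le_of_nonpos_right (Finset.sum_nonpos fun b _ => ?_)
  rcases eq_or_ne p b with rfl | h
  · rw [hp, mul_zero]
  · exact mul_nonpos_of_nonpos_of_nonneg (gram_nonpos h) (hx b)

lemma form_add_smul_single (x : B → ℝ) (p : B) (a : ℝ) :
    form M (x + a • Pi.single p 1) (x + a • Pi.single p 1)
      = form M x x + 2 * a * form M (Pi.single p 1) x + a ^ 2 := by
  simp only [map_add, map_smul, LinearMap.add_apply, LinearMap.smul_apply, smul_eq_mul,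
    form_symm M x, form_single, gram_self]
  ring

/-- The energy of a nonnegative vector supported on a tree (with `π` the parent map) is at most what
the edges of the tree give. -/
lemma PosDefinite.tree (hM : PosDefinite M) {n : ℕ} (φ : ℕ → B) (c w : ℕ → ℝ) (π : ℕ → ℕ)
    (hinj : ∀ i j, i < j → j ≤ n → φ i ≠ φ j) (hc : ∀ t, 0 ≤ c t) (hc0 : 0 < c 0)
    (hπ : ∀ t < n, π t ≤ t) (hw : ∀ t < n, gram M (φ (t + 1)) (φ (π t)) ≤ -w t) :
    0 < c 0 ^ 2 + ∑ t ∈ Finset.range n, (c (t + 1) ^ 2 - 2 * c (t + 1) * (c (π t) * w t)) := by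
  suffices ∀ k ≤ n, ∃ x : B → ℝ, (∀ b, 0 ≤ x b) ∧ (∀ t ≤ k, x (φ t) = c t) ∧
      (∀ t, k < t → t ≤ n → x (φ t) = 0) ∧ form M x x ≤ c 0 ^ 2 +
        ∑ t ∈ Finset.range k, (c (t + 1) ^ 2 - 2 * c (t + 1) * (c (π t) * w t)) by
    obtain ⟨x, -, h1, -, h2⟩ := this n le_rfl
    refine (hM x ?_).trans_le h2
    intro h0
    have := h1 0 n.zero_le
    rw [h0] at this
    exact hc0.ne this
  intro k
  induction k with
  | zero =>
    intro _
    refine ⟨c 0 • Pi.single (φ 0) 1, fun b => ?_, ?_, ?_, ?_⟩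
    · rw [Pi.smul_apply, Pi.single_apply]
      split_ifs <;> simp [hc 0]
    · intro t ht
      obtain rfl : t = 0 := by omega
      simp
    · intro t ht htn
      simp [(hinj 0 t ht htn).symm]
    · simp [form_single, gram_self, sq]
  | succ k ih =>
    intro hk
    obtain ⟨x, hx, h1, h2, h3⟩ := ih (by omega)
    have hxk := h2 (k + 1) (by omega) hk
    refine ⟨x + c (k + 1) • Pi.single (φ (k + 1)) 1, fun b => ?_, ?_, ?_, ?_⟩
    · refine add_nonneg (hx b) ?_
      rw [Pi.smul_apply, Pi.single_apply]
      split_ifs <;> simp [hc (k + 1)]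
    · intro t ht
      rcases ht.lt_or_eq with ht | rfl
      · simp [h1 t (by omega), hinj t (k + 1) ht hk]
      · simp [hxk]
    · intro t ht htn
      simp [h2 t (by omega) htn, (hinj (k + 1) t ht htn).symm]
    · rw [form_add_smul_single, Finset.sum_range_succ]
      have h4 := form_single_le_sum (M := M) hx hxk {φ (π k)}
      rw [Finset.sum_singleton, h1 _ (hπ k (by omega))] at h4
      have h5 := mul_le_mul_of_nonneg_right (hw k (by omega)) (hc (π k))
      have h6 := mul_le_mul_of_nonneg_left (h4.trans h5)
        (mul_nonneg zero_le_two (hc (k + 1)))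
      linarith

/-- A nonempty set of vertices is *light* if its indicator vector has at most the energy of a single
vertex. Contracting a light set to a point does not increase the energy. -/
structure Light (M : CoxeterMatrix B) (S : Finset B) : Prop where
  nonempty : S.Nonempty
  le : form M (fun b => if b ∈ S then 1 else 0) (fun b => if b ∈ S then 1 else 0) ≤ 1

lemma Light.singleton (b : B) : Light M {b} := by
  refine ⟨Finset.singleton_nonempty b, ?_⟩
  have : (fun b' => if b' ∈ ({b} : Finset B) then (1 : ℝ) else 0) = Pi.single b 1 := by
    ext b'
    simp [Pi.single_apply]
  rw [this, form_single, gram_self]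

lemma Light.insert {S : Finset B} (hS : Light M S) {p q : B} (hp : p ∉ S) (hq : q ∈ S)
    (h : (coxeterDiagram M).Adj p q) : Light M (insert p S) := by
  refine ⟨Finset.insert_nonempty _ _, ?_⟩
  set u : B → ℝ := fun b => if b ∈ S then 1 else 0 with hu
  have : (fun b => if b ∈ Insert.insert p S then (1 : ℝ) else 0) = u + (1 : ℝ) • Pi.single p 1 := by
    ext b
    rcases eq_or_ne b p with rfl | hb
    · simp [hu, hp]
    · simp [hu, hb]
  rw [this, form_add_smul_single]
  have h1 := form_single_le_sum (M := M) (x := u) (fun b => by simp only [hu]; split_ifs <;> simp)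
    (p := p) (by simp [hu, hp]) {q}
  have h2 : u q = 1 := by simp [hu, hq]
  rw [Finset.sum_singleton, h2] at h1
  linarith [gram_le_neg_half h, hS.le]

/-- A vertex outside a light set has at most one neighbour in it. -/
lemma Light.eq_of_adj (hM : PosDefinite M) {S : Finset B} (hS : Light M S) {p q q' : B}
    (hp : p ∉ S) (hq : q ∈ S) (hq' : q' ∈ S) (h : (coxeterDiagram M).Adj p q)
    (h' : (coxeterDiagram M).Adj p q') : q = q' := by
  by_contra hne
  set u : B → ℝ := fun b => if b ∈ S then 1 else 0 with hu
  have h1 := form_single_le_sum (M := M) (x := u) (fun b => by simp only [hu]; split_ifs <;> simp)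
    (p := p) (by simp [hu, hp]) {q, q'}
  have h2 : u q = 1 := by simp [hu, hq]
  have h3 : u q' = 1 := by simp [hu, hq']
  rw [Finset.sum_pair hne, h2, h3] at h1
  have h4 : 0 < form M (u + (1 : ℝ) • Pi.single p 1) (u + (1 : ℝ) • Pi.single p 1) := by
    refine hM _ fun h0 => ?_
    have := congrFun h0 p
    simp [hu, hp] at this
  rw [form_add_smul_single] at h4
  linarith [gram_le_neg_half h, gram_le_neg_half h', hS.le]

/-- The star inequality around a light set: if the vertices `p` outside of it are joined to it with
`-⟨e_p, e_s⟩ ≥ a_p`, then `∑ a_p ^ 2 < 1`. -/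
lemma Light.star (hM : PosDefinite M) {S : Finset B} (hS : Light M S) (P : List (B × ℝ))
    (hnd : (P.map Prod.fst).Nodup) (hPS : ∀ p ∈ P, p.1 ∉ S) (ha : ∀ p ∈ P, 0 ≤ p.2)
    (hadj : ∀ p ∈ P, ∃ s ∈ S, gram M p.1 s ≤ -p.2) : (P.map fun p => p.2 ^ 2).sum < 1 := by
  suffices ∃ x : B → ℝ, (∀ b, 0 ≤ x b) ∧ (∀ s ∈ S, x s = 1) ∧
      (∀ b, b ∉ S → b ∉ P.map Prod.fst → x b = 0) ∧
      form M x x ≤ 1 - (P.map fun p => p.2 ^ 2).sum by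
    obtain ⟨x, -, h1, -, h2⟩ := this
    obtain ⟨s, hs⟩ := hS.nonempty
    have := hM x fun h0 => by simpa [h0] using h1 s hs
    linarith
  induction P with
  | nil =>
    refine ⟨fun b => if b ∈ S then 1 else 0, fun b => ?_, fun s hs => if_pos hs,
      fun b hb _ => if_neg hb, by simpa using hS.le⟩
    dsimp only
    split_ifs <;> simp
  | cons p P ih =>
    rw [List.map_cons, List.nodup_cons] at hnd
    obtain ⟨x, hx, h1, h2, h3⟩ := ih hnd.2 (fun q hq => hPS q (List.mem_cons_of_mem _ hq))
      (fun q hq => ha q (List.mem_cons_of_mem _ hq))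
      (fun q hq => hadj q (List.mem_cons_of_mem _ hq))
    have hpS := hPS p List.mem_cons_self
    have hap := ha p List.mem_cons_self
    have hxp := h2 p.1 hpS hnd.1
    refine ⟨x + p.2 • Pi.single p.1 1, fun b => ?_, fun s hs => ?_, fun b hb hb' => ?_, ?_⟩
    · refine add_nonneg (hx b) ?_
      rw [Pi.smul_apply, Pi.single_apply]
      split_ifs <;> simp [hap]
    · have : s ≠ p.1 := fun h => hpS (h ▸ hs)
      simp [h1 s hs, this]
    · rw [List.map_cons, List.mem_cons, not_or] at hb'
      simp [h2 b hb hb'.2, hb'.1]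
    · obtain ⟨s, hs, h4⟩ := hadj p List.mem_cons_self
      rw [form_add_smul_single, List.map_cons, List.sum_cons]
      have h5 := form_single_le_sum (M := M) hx hxp {s}
      rw [Finset.sum_singleton, h1 s hs, mul_one] at h5
      have h6 := mul_le_mul_of_nonneg_left (h5.trans h4) (mul_nonneg zero_le_two hap)
      linarith

end TestVectors

end Mixing

namespace Mixing

/-! ### Shapes of connected sets of vertices in the diagram -/

section Shapes

variable {B : Type*} {M : CoxeterMatrix B}

lemma eq_two_of_not_adj {p q : B} (hpq : p ≠ q) (h : ¬(coxeterDiagram M).Adj p q) : M p q = 2 := by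
  have h1 := M.off_diagonal p q hpq
  have h2 : ¬(2 < M p q ∨ M p q = 0) := fun h' => h ⟨hpq, h'⟩
  omega

/-- The distinct vertices `v 0, …, v (n - 1)` induce a path in the diagram. -/
structure Chain (M : CoxeterMatrix B) (v : ℕ → B) (n : ℕ) : Prop where
  pos : 0 < n
  adj : ∀ i, i + 1 < n → (coxeterDiagram M).Adj (v i) (v (i + 1))
  far : ∀ i j, i + 1 < j → j < n → M (v i) (v j) = 2

/-- The vertices `v 0, …, v (n - 1)` induce a path in the diagram, and the vertex `r` is joined to
the inner vertex `v k` of it and to no other one. -/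
structure Tripod (M : CoxeterMatrix B) (v : ℕ → B) (n k : ℕ) (r : B) : Prop where
  chain : Chain M v n
  pos : 0 < k
  lt : k + 1 < n
  adj : (coxeterDiagram M).Adj r (v k)
  far : ∀ i < n, i ≠ k → M r (v i) = 2

variable {v : ℕ → B} {n k : ℕ} {r : B}

lemma Chain.ne (C : Chain M v n) {i j : ℕ} (hi : i < n) (hj : j < n) (hij : i ≠ j) :
    v i ≠ v j := by
  wlog h : i < j generalizing i j
  · exact (this hj hi hij.symm (by omega)).symm
  rcases (show i + 1 ≤ j from h).eq_or_lt with rfl | h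
  · exact (C.adj i hj).ne
  · intro e
    have := C.far i j h hj
    rw [e, M.diagonal] at this
    omega

lemma Chain.reverse (C : Chain M v n) : Chain M (fun i => v (n - 1 - i)) n := by
  refine ⟨C.pos, fun i hi => ?_, fun i j hij hj => ?_⟩
  · have := C.adj (n - 1 - (i + 1)) (by omega)
    rw [show n - 1 - (i + 1) + 1 = n - 1 - i by omega] at this
    exact this.symm
  · rw [M.symmetric]
    exact C.far _ _ (by omega) (by omega)

lemma Tripod.reverse (T : Tripod M v n k r) : Tripod M (fun i => v (n - 1 - i)) n (n - 1 - k) r := by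
  have := T.lt
  have := T.pos
  refine ⟨T.chain.reverse, by omega, by omega, ?_, fun i hi hik => T.far _ (by omega) (by omega)⟩
  rw [show n - 1 - (n - 1 - k) = k by omega]
  exact T.adj

lemma Chain.sub (C : Chain M v n) {a m : ℕ} (hm : 0 < m) (ham : a + m ≤ n) :
    Chain M (fun i => v (a + i)) m :=
  ⟨hm, fun i hi => C.adj (a + i) (by omega), fun _ _ hij hj => C.far _ _ (by omega) (by omega)⟩

lemma Chain.snoc (C : Chain M v n) {p : B} (hp : (coxeterDiagram M).Adj p (v (n - 1)))
    (hfar : ∀ i, i + 1 < n → M p (v i) = 2) :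
    Chain M (fun i => if i < n then v i else p) (n + 1) := by
  have hn := C.pos
  refine ⟨by omega, fun i hi => ?_, fun i j hij hj => ?_⟩
  · rcases (show i + 1 ≤ n by omega).lt_or_eq with h | rfl
    · rw [if_pos (by omega), if_pos h]
      exact C.adj i h
    · rw [if_pos (by omega), if_neg (by omega)]
      exact hp.symm
  · rcases (show j ≤ n by omega).lt_or_eq with h | rfl
    · rw [if_pos (by omega), if_pos h]
      exact C.far i j hij h
    · rw [if_pos (by omega), if_neg (by omega), M.symmetric]
      exact hfar i hij

lemma Tripod.ne (T : Tripod M v n k r) {i : ℕ} (hi : i < n) : r ≠ v i := by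
  rcases eq_or_ne i k with rfl | h
  · exact T.adj.ne
  · intro e
    have := T.far i hi h
    rw [← e, M.diagonal] at this
    omega

lemma Tripod.snoc (T : Tripod M v n k r) {p : B} (hp : (coxeterDiagram M).Adj p (v (n - 1)))
    (hfar : ∀ i, i + 1 < n → M p (v i) = 2) (hr : M p r = 2) :
    Tripod M (fun i => if i < n then v i else p) (n + 1) k r := by
  have := T.lt
  refine ⟨T.chain.snoc hp hfar, T.pos, by omega, ?_, fun i hi hik => ?_⟩
  · rw [if_pos (by omega)]
    exact T.adj
  · rcases (show i ≤ n by omega).lt_or_eq with h | rfl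
    · rw [if_pos h]
      exact T.far i h hik
    · rw [if_neg (by omega), M.symmetric]
      exact hr

/-- If the arm `v 0` has length one, then extending the arm `r` gives a new tripod, in which the
arms `v 0` and `r` have changed roles. -/
lemma Tripod.extend_side (T : Tripod M v n 1 r) {p : B} (hp : (coxeterDiagram M).Adj p r)
    (hfar : ∀ i < n, M p (v i) = 2) :
    Tripod M (fun i => if i = 0 then p else if i = 1 then r else v (i - 1)) (n + 1) 2 (v 0) := by
  have hn := T.lt
  refine ⟨⟨by omega, fun i hi => ?_, fun i j hij hj => ?_⟩, by omega, by omega, ?_,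
    fun i hi hi2 => ?_⟩
  · rcases i with _ | _ | i
    · simpa using hp
    · simpa using T.adj
    · simpa using T.chain.adj (i + 1) (by omega)
  · obtain ⟨j, rfl⟩ : ∃ j', j = j' + 2 := ⟨j - 2, by omega⟩
    rcases i with _ | _ | i
    · simpa using hfar (j + 1) (by omega)
    · simpa using T.far (j + 1) (by omega) (by omega)
    · simpa using T.chain.far (i + 1) (j + 1) (by omega) (by omega)
  · simpa using T.chain.adj 0 (by omega)
  · rcases i with _ | _ | _ | i
    · simpa [M.symmetric (v 0)] using hfar 0 (by omega)
    · simpa [M.symmetric (v 0)] using T.far 0 (by omega) (by omega)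
    · omega
    · simpa using T.chain.far 0 (i + 2) (by omega) (by omega)

lemma exists_lt_snoc {p b : B} : (∃ i < n + 1, (if i < n then v i else p) = b) ↔
    b = p ∨ ∃ i < n, v i = b := by
  constructor
  · rintro ⟨i, hi, rfl⟩
    split_ifs with h
    · exact Or.inr ⟨i, h, rfl⟩
    · exact Or.inl rfl
  · rintro (rfl | ⟨i, hi, rfl⟩)
    · exact ⟨n, by omega, if_neg (by omega)⟩
    · exact ⟨i, by omega, if_pos hi⟩

lemma exists_lt_reverse {b : B} : (∃ i < n, v (n - 1 - i) = b) ↔ ∃ i < n, v i = b := by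
  constructor
  · rintro ⟨i, hi, rfl⟩
    exact ⟨n - 1 - i, by omega, rfl⟩
  · rintro ⟨i, hi, rfl⟩
    exact ⟨n - 1 - i, by omega, by rw [show n - 1 - (n - 1 - i) = i by omega]⟩

variable [DecidableEq B]

lemma Chain.notMem_segment (C : Chain M v n) {i j a : ℕ} (hj : j < n) (ha : a < n)
    (h : a < i ∨ j < a) : v a ∉ (Finset.Icc i j).image v := by
  simp only [Finset.mem_image, Finset.mem_Icc, not_exists, not_and]
  exact fun b hb => C.ne (by omega) ha (by omega)

lemma Chain.mem_segment {i j a : ℕ} (hi : i ≤ a) (hj : a ≤ j) : v a ∈ (Finset.Icc i j).image v :=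
  Finset.mem_image_of_mem v (Finset.mem_Icc.mpr ⟨hi, hj⟩)

lemma Chain.eq_segment (C : Chain M v n) {S : Finset B} (hS : ∀ b, b ∈ S ↔ ∃ i < n, v i = b) :
    S = (Finset.Icc 0 (n - 1)).image v := by
  have := C.pos
  ext b
  simp only [hS, Finset.mem_image, Finset.mem_Icc]
  exact ⟨fun ⟨i, hi, e⟩ => ⟨i, by omega, e⟩, fun ⟨i, hi, e⟩ => ⟨i, by omega, e⟩⟩

variable [Fintype B]

lemma Chain.light_segment (C : Chain M v n) {i j : ℕ} (hij : i ≤ j) (hj : j < n) :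
    Light M ((Finset.Icc i j).image v) := by
  induction j, hij using Nat.le_induction with
  | base => simpa using Light.singleton (v i)
  | succ j hij ih =>
    have h1 : Finset.Icc i (j + 1) = insert (j + 1) (Finset.Icc i j) := by
      ext a
      simp only [Finset.mem_Icc, Finset.mem_insert]
      omega
    rw [h1, Finset.image_insert]
    refine (ih (by omega)).insert (q := v j) ?_ ?_ (C.adj j hj).symm
    · simp only [Finset.mem_image, Finset.mem_Icc, not_exists, not_and]
      exact fun a ha => C.ne (by omega) hj (by omega)
    · exact Finset.mem_image_of_mem v (Finset.mem_Icc.mpr ⟨hij, le_rfl⟩)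

/-- A second branch vertex, or a fourth edge at the branch vertex, is impossible. -/
lemma Tripod.not_adj_of_le (hM : PosDefinite M) (T : Tripod M v n k r) {p : B} {j : ℕ} (hj : 0 < j)
    (hjk : j ≤ k) (hp : (coxeterDiagram M).Adj p (v j)) (hpr : p ≠ r) (hpv : ∀ i < n, p ≠ v i) :
    False := by
  have hk := T.lt
  have C := T.chain
  have h1 := (C.light_segment hjk (by omega)).star hM
    [(v (j - 1), 1 / 2), (p, 1 / 2), (v (k + 1), 1 / 2), (r, 1 / 2)] ?_ ?_ ?_ ?_
  · norm_num at h1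
  · have := C.ne (i := j - 1) (j := k + 1) (by omega) (by omega) (by omega)
    simp [this, hpr, hpv (k + 1) (by omega), (hpv (j - 1) (by omega)).symm,
      (T.ne (i := j - 1) (by omega)).symm, (T.ne (i := k + 1) (by omega)).symm]
  · simp only [List.forall_mem_cons, List.not_mem_nil, false_imp_iff, implies_true, and_true]
    refine ⟨C.notMem_segment (by omega) (by omega) (by omega), ?_,
      C.notMem_segment (by omega) (by omega) (by omega), ?_⟩
    · simp only [Finset.mem_image, Finset.mem_Icc, not_exists, not_and]
      exact fun a ha => (hpv a (by omega)).symm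
    · simp only [Finset.mem_image, Finset.mem_Icc, not_exists, not_and]
      exact fun a ha => (T.ne (by omega)).symm
  · simp
  · simp only [List.forall_mem_cons, List.not_mem_nil, false_imp_iff, implies_true, and_true]
    have h2 := C.adj (j - 1) (by omega)
    rw [show j - 1 + 1 = j by omega] at h2
    exact ⟨⟨_, Chain.mem_segment le_rfl hjk, gram_le_neg_half h2⟩,
      ⟨_, Chain.mem_segment le_rfl hjk, gram_le_neg_half hp⟩,
      ⟨_, Chain.mem_segment hjk le_rfl, gram_le_neg_half (C.adj k hk).symm⟩,
      ⟨_, Chain.mem_segment hjk le_rfl, gram_le_neg_half T.adj⟩⟩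

/-- Three arms of length at least two are impossible: the diagram would contain the affine diagram
of type `E₆`. -/
lemma Tripod.not_adj_side (hM : PosDefinite M) (T : Tripod M v n k r) {p : B} (hk : 2 ≤ k)
    (hkn : k + 2 < n) (hp : (coxeterDiagram M).Adj p r) (hpv : ∀ i < n, p ≠ v i) : False := by
  have C := T.chain
  have hadj : ∀ i, i + 1 < n → gram M (v (i + 1)) (v i) ≤ -(1 / 2) := fun i hi =>
    gram_le_neg_half (C.adj i hi).symm
  have hadj' : ∀ i, 0 < i → i < n → gram M (v (i - 1)) (v i) ≤ -(1 / 2) := fun i hi hin => by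
    have := C.adj (i - 1) (by omega)
    rw [show i - 1 + 1 = i by omega] at this
    exact gram_le_neg_half this
  have h := hM.tree (n := 6)
    (fun t => [v k, v (k - 1), v (k - 1 - 1), v (k + 1), v (k + 1 + 1), r].getD t p)
    (fun t => [3, 2, 1, 2, 1, 2].getD t 1) (fun _ => 1 / 2) (fun t => [0, 1, 0, 3, 0].getD t 5)
    ?_ ?_ ?_ ?_ ?_
  · norm_num [Finset.sum_range_succ] at h
  · intro i j hij hj
    interval_cases j <;> interval_cases i <;>
      first
        | exact C.ne (by omega) (by omega) (by omega)
        | exact (T.ne (by omega)).symm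
        | exact (hpv _ (by omega)).symm
        | exact hp.ne'
  · intro t
    rcases t with _ | _ | _ | _ | _ | _ | t <;> norm_num
  · norm_num
  · intro t ht
    interval_cases t <;> simp
  · intro t ht
    interval_cases t
    · exact hadj' k (by omega) (by omega)
    · exact hadj' (k - 1) (by omega) (by omega)
    · exact hadj k (by omega)
    · exact hadj (k + 1) (by omega)
    · exact gram_le_neg_half T.adj
    · exact gram_le_neg_half hp

/-- The set `S` consists of the vertices of a chain or of a tripod. -/
def Shape (M : CoxeterMatrix B) (S : Finset B) : Prop :=
  (∃ v n, Chain M v n ∧ ∀ b, b ∈ S ↔ ∃ i < n, v i = b) ∨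
    ∃ v n k r, Tripod M v n k r ∧ ∀ b, b ∈ S ↔ b = r ∨ ∃ i < n, v i = b

lemma Shape.light {S : Finset B} (hS : Shape M S) : Light M S := by
  rcases hS with ⟨v, n, C, hS⟩ | ⟨v, n, k, r, T, hS⟩
  · have := C.pos
    rw [C.eq_segment hS]
    exact C.light_segment (Nat.zero_le _) (by omega)
  · have := T.lt
    have : S = insert r ((Finset.Icc 0 (n - 1)).image v) := by
      ext b
      simp only [hS, Finset.mem_insert, Finset.mem_image, Finset.mem_Icc]
      exact or_congr_right
        ⟨fun ⟨i, hi, e⟩ => ⟨i, by omega, e⟩, fun ⟨i, hi, e⟩ => ⟨i, by omega, e⟩⟩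
    rw [this]
    refine (T.chain.light_segment (Nat.zero_le _) (by omega)).insert ?_
      (Chain.mem_segment (Nat.zero_le _) (by omega)) T.adj
    simp only [Finset.mem_image, Finset.mem_Icc, not_exists, not_and]
    exact fun a ha => (T.ne (by omega)).symm

/-- A chain or tripod together with one more adjacent vertex is again a chain or a tripod. -/
lemma Shape.insert (hM : PosDefinite M) {S : Finset B} (hS : Shape M S) {p q : B} (hp : p ∉ S)
    (hq : q ∈ S) (hpq : (coxeterDiagram M).Adj p q) : Shape M (insert p S) := by
  have htwo : ∀ s ∈ S, s ≠ q → M p s = 2 := fun s hs hsq =>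
    eq_two_of_not_adj (fun e => hp (e ▸ hs)) fun h => hsq (hS.light.eq_of_adj hM hp hs hq h hpq)
  rcases hS with ⟨v, n, C, hS⟩ | ⟨v, n, k, r, T, hS⟩
  · have hn := C.pos
    obtain ⟨j, hj, rfl⟩ := (hS q).mp hq
    have hfar : ∀ i < n, i ≠ j → M p (v i) = 2 := fun i hi hij =>
      htwo _ ((hS _).mpr ⟨i, hi, rfl⟩) (C.ne hi hj hij)
    rcases eq_or_ne j (n - 1) with rfl | hjn
    · refine Or.inl ⟨_, _, C.snoc hpq fun i hi => hfar i (by omega) (by omega), fun b => ?_⟩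
      rw [Finset.mem_insert, hS, exists_lt_snoc]
    rcases Nat.eq_zero_or_pos j with rfl | hj0
    · refine Or.inl ⟨_, _, C.reverse.snoc (p := p) (by simpa using hpq)
        fun i hi => hfar _ (by omega) (by omega), fun b => ?_⟩
      rw [Finset.mem_insert, hS, exists_lt_snoc (v := fun i => v (n - 1 - i)), exists_lt_reverse]
    · refine Or.inr ⟨v, n, j, p, ⟨C, hj0, by omega, hpq, hfar⟩, fun b => ?_⟩
      rw [Finset.mem_insert, hS]
  · have hk := T.lt
    have hk0 := T.pos
    have hr : r ∈ S := (hS r).mpr (Or.inl rfl)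
    have hpr : p ≠ r := fun e => hp (e ▸ hr)
    have hpv : ∀ i < n, p ≠ v i := fun i hi e => hp (e ▸ (hS _).mpr (Or.inr ⟨i, hi, rfl⟩))
    rcases (hS q).mp hq with rfl | ⟨j, hj, rfl⟩
    · have hfar : ∀ i < n, M p (v i) = 2 := fun i hi =>
        htwo _ ((hS _).mpr (Or.inr ⟨i, hi, rfl⟩)) (T.ne hi).symm
      rcases eq_or_ne k 1 with rfl | hk1
      · refine Or.inr ⟨_, _, _, _, T.extend_side hpq hfar, fun b => ?_⟩
        rw [Finset.mem_insert, hS]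
        constructor
        · rintro (rfl | rfl | ⟨i, hi, rfl⟩)
          · exact Or.inr ⟨0, by omega, by simp⟩
          · exact Or.inr ⟨1, by omega, by simp⟩
          · rcases i with _ | i
            · exact Or.inl rfl
            · exact Or.inr ⟨i + 2, by omega, by simp⟩
        · rintro (rfl | ⟨i, hi, rfl⟩)
          · exact Or.inr (Or.inr ⟨0, by omega, rfl⟩)
          · rcases i with _ | _ | i
            · simp
            · simp
            · exact Or.inr (Or.inr ⟨i + 1, by omega, by simp⟩)
      rcases eq_or_ne (k + 2) n with hkn | hkn
      · have T' := T.reverse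
        rw [show n - 1 - k = 1 by omega] at T'
        refine Or.inr ⟨_, _, _, _, T'.extend_side hpq fun i hi => hfar _ (by omega), fun b => ?_⟩
        rw [Finset.mem_insert, hS]
        constructor
        · rintro (rfl | rfl | ⟨i, hi, rfl⟩)
          · exact Or.inr ⟨0, by omega, by simp⟩
          · exact Or.inr ⟨1, by omega, by simp⟩
          · rcases eq_or_ne i (n - 1) with rfl | hin
            · exact Or.inl rfl
            · refine Or.inr ⟨n - i, by omega, ?_⟩
              rw [if_neg (by omega), if_neg (by omega)]
              congr 1
              omega
        · rintro (rfl | ⟨i, hi, rfl⟩)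
          · exact Or.inr (Or.inr ⟨n - 1, by omega, rfl⟩)
          · rcases i with _ | _ | i
            · simp
            · simp
            · exact Or.inr (Or.inr ⟨n - 1 - (i + 1), by omega, by simp⟩)
      exact (T.not_adj_side hM (by omega) (by omega) hpq hpv).elim
    · have hfar : ∀ i < n, i ≠ j → M p (v i) = 2 := fun i hi hij =>
        htwo _ ((hS _).mpr (Or.inr ⟨i, hi, rfl⟩)) (T.chain.ne hi hj hij)
      have hpr2 : M p r = 2 := htwo r hr (T.ne hj)
      rcases eq_or_ne j (n - 1) with rfl | hjn
      · refine Or.inr ⟨_, _, _, _, T.snoc hpq (fun i hi => hfar i (by omega) (by omega)) hpr2,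
          fun b => ?_⟩
        rw [Finset.mem_insert, hS, exists_lt_snoc, or_left_comm]
      rcases Nat.eq_zero_or_pos j with rfl | hj0
      · refine Or.inr ⟨_, _, _, _, T.reverse.snoc (p := p) (by simpa using hpq)
          (fun i hi => hfar _ (by omega) (by omega)) hpr2, fun b => ?_⟩
        rw [Finset.mem_insert, hS, exists_lt_snoc (v := fun i => v (n - 1 - i)), exists_lt_reverse,
          or_left_comm]
      rcases le_or_gt j k with hjk | hjk
      · exact (T.not_adj_of_le hM hj0 hjk hpq hpr hpv).elim
      · refine (T.reverse.not_adj_of_le hM (p := p) (j := n - 1 - j) (by omega) (by omega) ?_ hpr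
          fun i hi => hpv _ (by omega)).elim
        rw [show n - 1 - (n - 1 - j) = j by omega]
        exact hpq

/-- A connected diagram with positive definite form is a chain or a tripod. -/
theorem shape_univ (hM : PosDefinite M) (hirr : IsIrreducible M) : Shape M Finset.univ := by
  obtain ⟨b₀⟩ := hirr.nonempty
  have hsing : Shape M {b₀} := by
    refine Or.inl ⟨fun _ => b₀, 1, ⟨one_pos, fun i hi => by omega, fun i j hij hj => by omega⟩,
      fun b => ?_⟩
    simp only [Finset.mem_singleton]
    exact ⟨fun h => ⟨0, one_pos, h.symm⟩, fun ⟨_, _, h⟩ => h.symm⟩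
  obtain ⟨S, hS, hmax⟩ := (Set.toFinite {S : Finset B | Shape M S}).exists_maximal ⟨_, hsing⟩
  suffices S = Finset.univ from this ▸ hS
  by_contra hne
  obtain ⟨b, hb⟩ : ∃ b, b ∉ S := by
    by_contra! h
    exact hne (Finset.eq_univ_iff_forall.mpr h)
  obtain ⟨a, ha⟩ := (Shape.light hS).nonempty
  obtain ⟨w⟩ := hirr.preconnected a b
  obtain ⟨d, -, hd1, hd2⟩ := w.exists_boundary_dart (S : Set B) ha hb
  have := hmax (Shape.insert hM hS hd2 hd1 d.adj.symm) (Finset.subset_insert _ _)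
  exact hd2 (this (Finset.mem_insert_self _ _))

end Shapes

end Mixing

namespace Mixing

/-! ### Labels of the edges -/

section Labels

variable {B : Type*} {M : CoxeterMatrix B} {v : ℕ → B} {n k : ℕ} {r : B}

lemma gram_le_of_four_le {p q : B} (h : 4 ≤ M p q) : gram M p q ≤ -(√2 / 2) := by
  have := gram_le_neg_cos (M := M) (m := 4) (by norm_num) (Or.inl h)
  rwa [Nat.cast_ofNat, Real.cos_pi_div_four] at this

lemma gram_le_of_five_le {p q : B} (h : 5 ≤ M p q) : gram M p q ≤ -(4 / 5) := by
  have := gram_le_neg_cos (M := M) (m := 5) (by norm_num) (Or.inl h)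
  rw [Nat.cast_ofNat, Real.cos_pi_div_five] at this
  have h5 : (11 / 5 : ℝ) ≤ √5 := Real.le_sqrt_of_sq_le (by norm_num)
  linarith

lemma gram_le_of_six_le {p q : B} (h : 6 ≤ M p q) : gram M p q ≤ -(√3 / 2) := by
  have := gram_le_neg_cos (M := M) (m := 6) (by norm_num) (Or.inl h)
  rwa [Nat.cast_ofNat, Real.cos_pi_div_six] at this

lemma Chain.gram_le (C : Chain M v n) {i : ℕ} (hi : i + 1 < n) :
    gram M (v (i + 1)) (v i) ≤ -(1 / 2) := gram_le_neg_half (C.adj i hi).symm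

lemma eq_three_of_adj_of_lt {p q : B} (h : (coxeterDiagram M).Adj p q) (h0 : M p q ≠ 0)
    (h4 : M p q < 4) : M p q = 3 := by
  have := h.2
  omega

variable [Fintype B] [DecidableEq B]

lemma PosDefinite.ne_zero (hM : PosDefinite M) {p q : B} (hpq : p ≠ q) : M p q ≠ 0 := by
  intro h0
  have h := (Light.singleton q).star hM [(p, 1)] (by simp) (by simpa using hpq) (by simp) ?_
  · norm_num at h
  · simp [gram, h0]

/-- A chain has at most one edge with label at least `4`. -/
lemma Chain.not_two_heavy (hM : PosDefinite M) (C : Chain M v n) {i j : ℕ} (hij : i < j)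
    (hj : j + 1 < n) (h4i : 4 ≤ M (v i) (v (i + 1))) (h4j : 4 ≤ M (v j) (v (j + 1))) : False := by
  have h := (C.light_segment (i := i + 1) (j := j) hij (by omega)).star hM
    [(v i, √2 / 2), (v (j + 1), √2 / 2)] ?_ ?_ ?_ ?_
  · norm_num [div_pow] at h
  · simpa using C.ne (by omega) hj (by omega)
  · simp only [List.forall_mem_cons, List.not_mem_nil, false_imp_iff, implies_true, and_true]
    exact ⟨C.notMem_segment (by omega) (by omega) (by omega),
      C.notMem_segment (by omega) (by omega) (by omega)⟩
  · simp only [List.forall_mem_cons, List.not_mem_nil, false_imp_iff, implies_true, and_true]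
    constructor <;> positivity
  · simp only [List.forall_mem_cons, List.not_mem_nil, false_imp_iff, implies_true, and_true]
    rw [M.symmetric] at h4j
    exact ⟨⟨_, Chain.mem_segment le_rfl hij, gram_le_of_four_le h4i⟩,
      ⟨_, Chain.mem_segment hij le_rfl, gram_le_of_four_le h4j⟩⟩

/-- An edge with label at least `6` is not followed by another one. -/
lemma Chain.not_six (hM : PosDefinite M) (C : Chain M v n) {i : ℕ}
    (hi : i + 2 < n) (h6 : 6 ≤ M (v i) (v (i + 1))) : False := by
  have h := (Light.singleton (v (i + 1))).star hM
    [(v i, √3 / 2), (v (i + 2), 1 / 2)] ?_ ?_ ?_ ?_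
  · norm_num [div_pow] at h
  · simpa using C.ne (by omega) hi (by omega)
  · simpa using ⟨C.ne (i := i) (j := i + 1) (by omega) (by omega) (by omega),
      C.ne (i := i + 2) (j := i + 1) (by omega) (by omega) (by omega)⟩
  · simp only [List.forall_mem_cons, List.not_mem_nil, false_imp_iff, implies_true, and_true]
    constructor <;> positivity
  · simp only [List.forall_mem_cons, List.not_mem_nil, false_imp_iff, implies_true, and_true]
    exact ⟨⟨_, Finset.mem_singleton_self _, gram_le_of_six_le h6⟩,
      ⟨_, Finset.mem_singleton_self _, C.gram_le (i := i + 1) (by omega)⟩⟩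

/-- The labels `3, 4, 3, 3` (the affine diagram of type `F₄`) do not occur. -/
lemma Chain.not_affine_F₄ (hM : PosDefinite M) (C : Chain M v n) {i : ℕ} (hi : i + 4 < n)
    (h4 : 4 ≤ M (v (i + 1)) (v (i + 2))) : False := by
  -- The coefficients span the radical of the form of the affine diagram.
  have h := hM.tree (n := 4) (fun t => v (i + t)) (fun t => [√2, 2 * √2, 3, 2].getD t 1)
    (fun t => [1 / 2, √2 / 2, 1 / 2].getD t (1 / 2)) id ?_ ?_ ?_ ?_ ?_
  · simp only [Finset.sum_range_succ, Finset.sum_range_zero, id_eq, List.getD_cons_zero,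
      List.getD_cons_succ, List.getD_nil, zero_add] at h
    nlinarith [Real.sq_sqrt (zero_le_two (α := ℝ))]
  · exact fun a b hab hb => C.ne (by omega) (by omega) (by omega)
  · intro t
    rcases t with _ | _ | _ | _ | t <;> simp
  · simp
  · simp
  · intro t ht
    rw [M.symmetric] at h4
    interval_cases t
    · exact C.gram_le (i := i) (by omega)
    · exact gram_le_of_four_le h4
    · exact C.gram_le (i := i + 2) (by omega)
    · exact C.gram_le (i := i + 3) (by omega)

/-- The labels `3, 5, 3` do not occur. -/
lemma Chain.not_three_five_three (hM : PosDefinite M) (C : Chain M v n) {i : ℕ} (hi : i + 3 < n)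
    (h5 : 5 ≤ M (v (i + 1)) (v (i + 2))) : False := by
  -- The form is indefinite on these labels, so a vector of negative energy exists with `cos (π / 5)`
  -- rounded down to `4 / 5`.
  have h := hM.tree (n := 3) (fun t => v (i + t)) (fun t => [1, 2, 2].getD t 1)
    (fun t => [1 / 2, 4 / 5].getD t (1 / 2)) id ?_ ?_ ?_ ?_ ?_
  · norm_num [Finset.sum_range_succ] at h
  · exact fun a b hab hb => C.ne (by omega) (by omega) (by omega)
  · intro t
    rcases t with _ | _ | _ | t <;> simp
  · simp
  · simp
  · intro t ht
    rw [M.symmetric] at h5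
    interval_cases t
    · exact C.gram_le (i := i) (by omega)
    · exact gram_le_of_five_le h5
    · exact C.gram_le (i := i + 2) (by omega)

/-- The labels `5, 3, 3, 3` do not occur. -/
lemma Chain.not_five_three_three_three (hM : PosDefinite M) (C : Chain M v n) {i : ℕ}
    (hi : i + 4 < n) (h5 : 5 ≤ M (v i) (v (i + 1))) : False := by
  -- The form is indefinite on these labels, so a vector of negative energy exists with `cos (π / 5)`
  -- rounded down to `4 / 5`.
  have h := hM.tree (n := 4) (fun t => v (i + t)) (fun t => [3, 4, 3, 2].getD t 1)
    (fun t => [4 / 5].getD t (1 / 2)) id ?_ ?_ ?_ ?_ ?_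
  · norm_num [Finset.sum_range_succ] at h
  · exact fun a b hab hb => C.ne (by omega) (by omega) (by omega)
  · intro t
    rcases t with _ | _ | _ | _ | t <;> simp
  · simp
  · simp
  · intro t ht
    rw [M.symmetric] at h5
    interval_cases t
    · exact gram_le_of_five_le h5
    · exact C.gram_le (i := i + 1) (by omega)
    · exact C.gram_le (i := i + 2) (by omega)
    · exact C.gram_le (i := i + 3) (by omega)

lemma Tripod.side_label (hM : PosDefinite M) (T : Tripod M v n k r) : M r (v k) < 4 := by
  by_contra! h4
  have hk := T.lt
  have hk0 := T.pos
  have C := T.chain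
  have h := (Light.singleton (v k)).star hM
    [(v (k - 1), 1 / 2), (v (k + 1), 1 / 2), (r, √2 / 2)] ?_ ?_ ?_ ?_
  · norm_num [div_pow] at h
  · have := C.ne (i := k - 1) (j := k + 1) (by omega) (by omega) (by omega)
    simp [this, (T.ne (i := k - 1) (by omega)).symm, (T.ne (i := k + 1) (by omega)).symm]
  · simpa using ⟨C.ne (i := k - 1) (j := k) (by omega) (by omega) (by omega),
      C.ne (i := k + 1) (j := k) (by omega) (by omega) (by omega), T.adj.ne⟩
  · simp only [List.forall_mem_cons, List.not_mem_nil, false_imp_iff, implies_true, and_true]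
    refine ⟨?_, ?_, ?_⟩ <;> positivity
  · simp only [List.forall_mem_cons, List.not_mem_nil, false_imp_iff, implies_true, and_true]
    have h2 := C.adj (k - 1) (by omega)
    rw [show k - 1 + 1 = k by omega] at h2
    exact ⟨⟨_, Finset.mem_singleton_self _, gram_le_neg_half h2⟩,
      ⟨_, Finset.mem_singleton_self _, C.gram_le hk⟩,
      ⟨_, Finset.mem_singleton_self _, gram_le_of_four_le h4⟩⟩

lemma Tripod.chain_label_of_le (hM : PosDefinite M) (T : Tripod M v n k r) {i : ℕ}
    (hi : i + 1 ≤ k) : M (v i) (v (i + 1)) < 4 := by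
  by_contra! h4
  have hk := T.lt
  have C := T.chain
  have h := (C.light_segment (i := i + 1) (j := k) hi (by omega)).star hM
    [(v i, √2 / 2), (v (k + 1), 1 / 2), (r, 1 / 2)] ?_ ?_ ?_ ?_
  · norm_num [div_pow] at h
  · have := C.ne (i := i) (j := k + 1) (by omega) (by omega) (by omega)
    simp [this, (T.ne (i := i) (by omega)).symm, (T.ne (i := k + 1) (by omega)).symm]
  · simp only [List.forall_mem_cons, List.not_mem_nil, false_imp_iff, implies_true, and_true]
    refine ⟨C.notMem_segment (by omega) (by omega) (by omega),
      C.notMem_segment (by omega) (by omega) (by omega), ?_⟩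
    simp only [Finset.mem_image, Finset.mem_Icc, not_exists, not_and]
    exact fun a ha => (T.ne (by omega)).symm
  · simp only [List.forall_mem_cons, List.not_mem_nil, false_imp_iff, implies_true, and_true]
    refine ⟨?_, ?_, ?_⟩ <;> positivity
  · simp only [List.forall_mem_cons, List.not_mem_nil, false_imp_iff, implies_true, and_true]
    exact ⟨⟨_, Chain.mem_segment le_rfl hi, gram_le_of_four_le h4⟩,
      ⟨_, Chain.mem_segment hi le_rfl, C.gram_le hk⟩,
      ⟨_, Chain.mem_segment hi le_rfl, gram_le_neg_half T.adj⟩⟩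

/-- A branched diagram has simple edges only. -/
lemma Tripod.chain_label (hM : PosDefinite M) (T : Tripod M v n k r) {i : ℕ} (hi : i + 1 < n) :
    M (v i) (v (i + 1)) = 3 := by
  refine eq_three_of_adj_of_lt (T.chain.adj i hi) (hM.ne_zero (T.chain.adj i hi).ne) ?_
  rcases le_or_gt (i + 1) k with h | h
  · exact T.chain_label_of_le hM h
  · have := T.reverse.chain_label_of_le hM (i := n - 1 - (i + 1)) (by omega)
    rw [M.symmetric]
    rwa [show n - 1 - (n - 1 - (i + 1)) = i + 1 by omega,
      show n - 1 - (n - 1 - (i + 1) + 1) = i by omega] at this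

/-- The affine diagram of type `E₇` does not occur. -/
lemma Tripod.not_affine_E₇ (hM : PosDefinite M) (T : Tripod M v n k r) (hk : 3 ≤ k)
    (hkn : k + 3 < n) : False := by
  have C := T.chain
  obtain ⟨a, rfl⟩ := Nat.exists_eq_add_of_le' hk
  -- The coefficients span the radical of the form of the affine diagram.
  have h := hM.tree (n := 7) (fun t => if t < 7 then v (a + t) else r)
    (fun t => [1, 2, 3, 4, 3, 2, 1].getD t 2) (fun _ => 1 / 2)
    (fun t => if t < 6 then t else 3) ?_ ?_ ?_ ?_ ?_
  · norm_num [Finset.sum_range_succ] at h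
  · intro i j hij hj
    rw [if_pos (by omega)]
    rcases hj.lt_or_eq with hj | rfl
    · rw [if_pos hj]
      exact C.ne (by omega) (by omega) (by omega)
    · exact (T.ne (by omega)).symm
  · intro t
    rcases t with _ | _ | _ | _ | _ | _ | _ | t <;> simp
  · simp
  · intro t ht
    split_ifs <;> omega
  · intro t ht
    rcases (show t ≤ 6 by omega).lt_or_eq with h | rfl
    · rw [if_pos (by omega), if_pos h, if_pos (by omega)]
      exact C.gram_le (i := a + t) (by omega)
    · exact gram_le_neg_half T.adj

/-- The affine diagram of type `E₈` does not occur. -/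
lemma Tripod.not_affine_E₈ (hM : PosDefinite M) (T : Tripod M v n 2 r) (hn : 8 ≤ n) : False := by
  have C := T.chain
  -- The coefficients span the radical of the form of the affine diagram.
  have h := hM.tree (n := 8) (fun t => if t < 8 then v t else r)
    (fun t => [2, 4, 6, 5, 4, 3, 2, 1].getD t 3) (fun _ => 1 / 2)
    (fun t => if t < 7 then t else 2) ?_ ?_ ?_ ?_ ?_
  · norm_num [Finset.sum_range_succ] at h
  · intro i j hij hj
    rw [if_pos (by omega)]
    rcases hj.lt_or_eq with hj | rfl
    · rw [if_pos hj]
      exact C.ne (by omega) (by omega) (by omega)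
    · exact (T.ne (by omega)).symm
  · intro t
    rcases t with _ | _ | _ | _ | _ | _ | _ | _ | t <;> simp
  · simp
  · intro t ht
    split_ifs <;> omega
  · intro t ht
    rcases (show t ≤ 7 by omega).lt_or_eq with h | rfl
    · rw [if_pos (by omega), if_pos h, if_pos (by omega)]
      exact C.gram_le (by omega)
    · exact gram_le_neg_half T.adj

end Labels

end Mixing

namespace Mixing

/-! ### Reachability for chains and tripods -/

section Conclusion

variable {B : Type*} {M : CoxeterMatrix B} {G : Type*} [Group G] (cs : CoxeterSystem M G)

lemma simple_comm {p q : B} (h : M p q = 2) :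
    cs.simple p * cs.simple q = cs.simple q * cs.simple p := by
  have h1 := cs.simple_mul_simple_pow p q
  rw [h, sq] at h1
  have h2 := inv_eq_self_of_sq h1
  rw [← h2, mul_inv_rev, cs.inv_simple, cs.inv_simple]

lemma simple_braid {p q : B} (h : M p q = 3) :
    cs.simple p * cs.simple q * cs.simple p = cs.simple q * cs.simple p * cs.simple q := by
  have h1 := cs.simple_mul_simple_pow p q
  rw [h, pow_succ, pow_two] at h1
  have h2 : (cs.simple p * cs.simple q * cs.simple p)
      * (cs.simple q * cs.simple p * cs.simple q) = 1 := by
    rw [← h1]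
    simp only [mul_assoc]
  rw [eq_inv_of_mul_eq_one_left h2]
  simp only [mul_inv_rev, cs.inv_simple, mul_assoc]

lemma initialSubgroup_reverse (s : ℕ → G) (n : ℕ) :
    initialSubgroup ∅ (fun i => s (n - 1 - i)) n = initialSubgroup ∅ s n := by
  rw [initialSubgroup, initialSubgroup]
  congr 2
  ext g
  simp only [Set.mem_image, Set.mem_Iio]
  exact exists_lt_reverse

variable {v : ℕ → B} {n k : ℕ} {r : B}

lemma Chain.reachable_typeB [Fintype G] (C : Chain M v n) (hn : 2 ≤ n) (h4 : M (v 0) (v 1) = 4)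
    (h3 : ∀ i, i + 1 < n → i ≠ 0 → M (v i) (v (i + 1)) = 3) :
    Reachable (initialSubgroup ∅ (fun i => cs.simple (v i)) n) := by
  refine Mixing.reachable_typeB hn (fun i _ => cs.simple_mul_simple_self _)
    (fun i j hj hij => (simple_comm cs (C.far i j hij hj)).symm)
    (fun i hi h1 => (simple_braid cs (h3 i hi (by omega))).symm) ?_
  have := cs.simple_mul_simple_pow (v 1) (v 0)
  rwa [M.symmetric, h4] at this

lemma pathOrder_pos {w : List ℕ} (hw : ∀ a ∈ w, 0 < a) (i j : ℕ) : 0 < pathOrder w i j := by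
  have h : ∀ i, 0 < w.getD i 2 := by
    intro i
    rw [List.getD_eq_getElem?_getD]
    rcases h : w[i]? with _ | a
    · simp
    · exact hw a (List.mem_of_getElem? h)
  rw [pathOrder]
  split_ifs <;> first | exact h _ | norm_num

lemma Chain.eq_pathOrder (C : Chain M v n) {w : List ℕ}
    (hw : ∀ i, i + 1 < n → M (v i) (v (i + 1)) = w.getD i 2) {i j : ℕ} (hi : i < n) (hj : j < n) :
    M (v i) (v j) = pathOrder w i j := by
  rw [pathOrder]
  split_ifs with h1 h2 h3
  · rw [h1, M.diagonal]
  · rw [← h2, hw i (by omega)]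
  · rw [M.symmetric, ← h3, hw j (by omega)]
  · rcases lt_or_gt_of_ne h1 with h | h
    · exact C.far i j (by omega) hj
    · rw [M.symmetric]
      exact C.far j i (by omega) hi

lemma Chain.reachable_of_table [Fintype G] (C : Chain M v n) {w : List ℕ} {t : List (List ℕ)}
    {m N : ℕ} (hw : ∀ i, i + 1 < n → M (v i) (v (i + 1)) = w.getD i 2) (hpos : ∀ a ∈ w, 0 < a)
    (hn : m < n) (ht : tableOk (pathOrder w) t m N = true) (hN : 0 < N)
    (hreach : Reachable (initialSubgroup ∅ (fun i => cs.simple (v i)) m)) :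
    Reachable (initialSubgroup ∅ (fun i => cs.simple (v i)) (m + 1)) := by
  refine reachable_of_tableOk ht hN (fun i _ => cs.simple_mul_simple_self _) (fun i hi j hj => ?_)
    (pathOrder_pos hpos) hreach
  rw [← C.eq_pathOrder hw (by omega) (by omega)]
  exact cs.simple_mul_simple_pow _ _

lemma reachable_initialSubgroup_two [Fintype G] (v : ℕ → B) :
    Reachable (initialSubgroup ∅ (fun i => cs.simple (v i)) 2) := by
  have h : initialSubgroup ∅ (fun i => cs.simple (v i)) 2
      = Subgroup.closure {cs.simple (v 0), cs.simple (v 1)} := by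
    rw [initialSubgroup]
    congr 1
    ext g
    simp only [Set.empty_union, Set.mem_image, Set.mem_Iio, Set.mem_insert_iff,
      Set.mem_singleton_iff]
    constructor
    · rintro ⟨i, hi, rfl⟩
      interval_cases i <;> simp
    · rintro (rfl | rfl)
      · exact ⟨0, by omega, rfl⟩
      · exact ⟨1, by omega, rfl⟩
  rw [h]
  exact reachable_closure_pair (cs.simple_mul_simple_self _) (cs.simple_mul_simple_self _)

lemma hasType_of_surjective {m : ℕ} {N : CoxeterMatrix (Fin m)} (φ : Fin m → B)
    (hsurj : Function.Surjective φ) (h : ∀ i j, M (φ i) (φ j) = N i j) : HasType M N := by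
  have hinj : Function.Injective φ := by
    intro i j hij
    by_contra hne
    apply N.off_diagonal i j hne
    rw [← h, hij, M.diagonal]
  refine ⟨(Equiv.ofBijective φ ⟨hinj, hsurj⟩).symm, ?_⟩
  ext i j
  exact h i j

lemma eq_top_of_cover {E : Set G} {s : ℕ → G} (h : ∀ b, cs.simple b ∈ E ∪ s '' Set.Iio n) :
    initialSubgroup E s n = ⊤ := by
  rw [eq_top_iff, ← cs.subgroup_closure_range_simple]
  refine Subgroup.closure_mono ?_
  rintro _ ⟨b, rfl⟩
  exact h b

variable [Fintype B] [DecidableEq B]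

/-- The case of a chain with an edge of label at least `4` in its first half. -/
lemma Chain.reachable_of_heavy [Fintype G] (hM : PosDefinite M) (C : Chain M v n) {i : ℕ}
    (hi : i + 1 < n) (hin : 2 * i + 2 ≤ n) (h4 : 4 ≤ M (v i) (v (i + 1))) :
    Reachable (initialSubgroup ∅ (fun i => cs.simple (v i)) n) := by
  have h3 : ∀ j, j + 1 < n → j ≠ i → M (v j) (v (j + 1)) = 3 := by
    intro j hj hji
    refine eq_three_of_adj_of_lt (C.adj j hj) (hM.ne_zero (C.adj j hj).ne) ?_
    by_contra! h
    rcases lt_or_gt_of_ne hji with h' | h'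
    · exact C.not_two_heavy hM h' hi h h4
    · exact C.not_two_heavy hM h' hj h4 h
  rcases eq_or_ne n 2 with rfl | hn2
  · exact reachable_initialSubgroup_two cs v
  have h6 : M (v i) (v (i + 1)) < 6 := by
    by_contra! h
    exact C.not_six hM (by omega) h
  rcases h4.eq_or_lt with h4 | h5
  · rcases Nat.eq_zero_or_pos i with rfl | hi0
    · exact C.reachable_typeB cs (by omega) h4.symm h3
    obtain ⟨i, rfl⟩ := Nat.exists_eq_add_of_lt hi0
    simp only [zero_add] at *
    have hn : ¬ i + 4 < n := fun h => C.not_affine_F₄ hM h h4.le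
    obtain ⟨rfl, rfl⟩ : i = 0 ∧ n = 4 := by omega
    refine C.reachable_of_table cs (w := [3, 4, 3]) (fun j hj => ?_) (by simp) (by omega)
      tableOk_F₄ (by norm_num) ?_
    · have hj' : j < 3 := by omega
      interval_cases j
      · exact h3 0 hj (by omega)
      · exact h4.symm
      · exact h3 2 hj (by omega)
    · have C' := (C.sub (a := 0) (m := 3) (by omega) (by omega)).reverse
      rw [← initialSubgroup_reverse]
      have h := C'.reachable_typeB cs (by omega) ?_ fun j hj hj0 => ?_
      · simpa using h
      · rw [M.symmetric]
        exact h4.symm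
      · obtain rfl : j = 1 := by omega
        rw [M.symmetric]
        exact h3 0 (by omega) (by omega)
  · have hm : M (v i) (v (i + 1)) = 5 := by omega
    rcases Nat.eq_zero_or_pos i with rfl | hi0
    · have hn : ¬ 4 < n := fun h => C.not_five_three_three_three hM (i := 0) h h5
      have h3' : Reachable (initialSubgroup ∅ (fun i => cs.simple (v i)) (2 + 1)) := by
        refine (C.sub (a := 0) (m := 3) (by omega) (by omega)).reachable_of_table cs (w := [5, 3])
          (fun j hj => ?_) (by simp) (by omega) tableOk_H₃ (by norm_num)
          (reachable_initialSubgroup_two cs _) |> fun h => by simpa using h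
        have hj' : j < 2 := by omega
        interval_cases j
        · exact hm
        · exact h3 1 (by omega) (by omega)
      rcases (show n = 3 ∨ n = 4 by omega) with rfl | rfl
      · exact h3'
      · refine C.reachable_of_table cs (w := [5, 3, 3]) (fun j hj => ?_) (by simp) (by omega)
          tableOk_H₄ (by norm_num) h3'
        have hj' : j < 3 := by omega
        interval_cases j
        · exact hm
        · exact h3 1 hj (by omega)
        · exact h3 2 hj (by omega)
    · obtain ⟨i, rfl⟩ := Nat.exists_eq_add_of_lt hi0
      simp only [zero_add] at *
      exact (C.not_three_five_three hM (by omega) h5).elim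

lemma Chain.reachable [Fintype G] (hM : PosDefinite M) (C : Chain M v n) :
    Reachable (initialSubgroup ∅ (fun i => cs.simple (v i)) n) := by
  by_cases hheavy : ∃ i, i + 1 < n ∧ 4 ≤ M (v i) (v (i + 1))
  · obtain ⟨i, hi, h4⟩ := hheavy
    rcases le_or_gt (2 * i + 2) n with hin | hin
    · exact C.reachable_of_heavy cs hM hi hin h4
    · rw [← initialSubgroup_reverse]
      refine C.reverse.reachable_of_heavy cs hM (i := n - 1 - (i + 1)) (by omega) (by omega) ?_
      rw [M.symmetric, show n - 1 - (n - 1 - (i + 1)) = i + 1 by omega,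
        show n - 1 - (n - 1 - (i + 1) + 1) = i by omega]
      exact h4
  · push Not at hheavy
    refine reachable_typeA (fun i _ => cs.simple_mul_simple_self _)
      (fun i j hj hij => (simple_comm cs (C.far i j hij hj)).symm) fun i hi => ?_
    exact (simple_braid cs (eq_three_of_adj_of_lt (C.adj i hi) (hM.ne_zero (C.adj i hi).ne)
      (hheavy i hi))).symm

lemma Tripod.side_label_eq (hM : PosDefinite M) (T : Tripod M v n k r) : M r (v k) = 3 :=
  eq_three_of_adj_of_lt T.adj (hM.ne_zero T.adj.ne) (T.side_label hM)

lemma Tripod.reachable_typeD [Fintype G] (hM : PosDefinite M) (T : Tripod M v n 1 r) :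
    Reachable (initialSubgroup {cs.simple r} (fun i => cs.simple (v i)) n) := by
  have hn := T.lt
  refine Mixing.reachable_typeD (by omega) (fun i _ => cs.simple_mul_simple_self _)
    (fun i j hj hij => (simple_comm cs (T.chain.far i j hij hj)).symm)
    (fun i hi => (simple_braid cs (T.chain_label hM hi)).symm) (cs.simple_mul_simple_self _)
    (simple_braid cs (T.side_label_eq hM)).symm
    (fun i hi hi1 => (simple_comm cs (T.far i hi hi1)).symm)

lemma Tripod.hasType (hM : PosDefinite M) (T : Tripod M v n 2 r)
    (hcover : ∀ b, b = r ∨ ∃ i < n, v i = b) {N : CoxeterMatrix (Fin (n + 1))}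
    (hN : ∀ i j : Fin (n + 1), N i j = if i = j then 1 else
      if (i : ℕ) = 1 ∨ (j : ℕ) = 1 then (if (i : ℕ) = 3 ∨ (j : ℕ) = 3 then 3 else 2)
      else if (i : ℕ) + 1 = j ∨ (j : ℕ) + 1 = i ∨ ((i : ℕ) = 0 ∧ (j : ℕ) = 2) ∨
        ((i : ℕ) = 2 ∧ (j : ℕ) = 0) then 3 else 2) : HasType M N := by
  have hn := T.lt
  have hchain : ∀ a < n, ∀ b < n, M (v a) (v b) =
      if a = b then 1 else if a + 1 = b ∨ b + 1 = a then 3 else 2 := by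
    intro a ha b hb
    split_ifs with h1 h2
    · rw [h1, M.diagonal]
    · rcases h2 with rfl | rfl
      · exact T.chain_label hM hb
      · rw [M.symmetric]
        exact T.chain_label hM ha
    · rcases lt_or_gt_of_ne h1 with h | h
      · exact T.chain.far a b (by omega) hb
      · rw [M.symmetric]
        exact T.chain.far b a (by omega) ha
  have hside : ∀ a < n, M r (v a) = if a = 2 then 3 else 2 := by
    intro a ha
    split_ifs with h
    · rw [h, T.side_label_eq hM]
    · exact T.far a ha h
  -- The vertex `r` gets the number `1` and the vertices of the chain get the others in their order;
  -- the truncated subtraction gives `v 0` the number `0`.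
  refine hasType_of_surjective (fun i => if (i : ℕ) = 1 then r else v (i - 1)) ?_ ?_
  · intro b
    rcases hcover b with rfl | ⟨i, hi, rfl⟩
    · exact ⟨⟨1, by omega⟩, if_pos rfl⟩
    · rcases Nat.eq_zero_or_pos i with rfl | hi0
      · exact ⟨⟨0, by omega⟩, rfl⟩
      · refine ⟨⟨i + 1, by omega⟩, ?_⟩
        simp [hi0.ne']
  · intro i j
    obtain ⟨i, hi⟩ := i
    obtain ⟨j, hj⟩ := j
    rw [hN]
    simp only [Fin.mk.injEq]
    rcases eq_or_ne i 1 with rfl | hi1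
    · rcases eq_or_ne j 1 with rfl | hj1
      · simp
      · rw [if_pos rfl, if_neg hj1, hside _ (by omega)]
        split_ifs <;> omega
    · rcases eq_or_ne j 1 with rfl | hj1
      · rw [if_pos rfl, if_neg hi1, M.symmetric, hside _ (by omega)]
        split_ifs <;> omega
      · rw [if_neg hi1, if_neg hj1, hchain _ (by omega) _ (by omega)]
        split_ifs <;> omega

/-- The case of a tripod whose arm `v 0` is not longer than the opposite one. -/
lemma Tripod.reachable_of_le [Fintype G] (hM : PosDefinite M) (T : Tripod M v n k r)
    (hk : 2 * k + 1 ≤ n) (hcover : ∀ b, b = r ∨ ∃ i < n, v i = b)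
    (hE₆ : ¬ HasType M CoxeterMatrix.E₆) (hE₇ : ¬ HasType M CoxeterMatrix.E₇)
    (hE₈ : ¬ HasType M CoxeterMatrix.E₈) :
    Reachable (initialSubgroup {cs.simple r} (fun i => cs.simple (v i)) n) := by
  have hk0 := T.pos
  rcases eq_or_ne k 1 with rfl | hk1
  · exact T.reachable_typeD cs hM
  exfalso
  rcases eq_or_ne k 2 with rfl | hk2
  · have hn : n < 8 := by
      by_contra! h
      exact T.not_affine_E₈ hM h
    rcases (show n = 5 ∨ n = 6 ∨ n = 7 by omega) with rfl | rfl | rfl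
    · exact hE₆ (T.hasType hM hcover (by intro i j; fin_cases i <;> fin_cases j <;> rfl))
    · exact hE₇ (T.hasType hM hcover (by intro i j; fin_cases i <;> fin_cases j <;> rfl))
    · exact hE₈ (T.hasType hM hcover (by intro i j; fin_cases i <;> fin_cases j <;> rfl))
  · exact T.not_affine_E₇ hM (by omega) (by omega)

theorem reachable_top [Fintype G] (cs : CoxeterSystem M G) (hirr : IsIrreducible M)
    (hE₆ : ¬ HasType M CoxeterMatrix.E₆) (hE₇ : ¬ HasType M CoxeterMatrix.E₇)
    (hE₈ : ¬ HasType M CoxeterMatrix.E₈) : Reachable (⊤ : Subgroup G) := by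
  have hM : PosDefinite M := fun _ hx => form_pos cs hirr hx
  rcases shape_univ hM hirr with ⟨v, n, C, hS⟩ | ⟨v, n, k, r, T, hS⟩
  · rw [← eq_top_of_cover cs (E := ∅) (s := fun i => cs.simple (v i)) (n := n) fun b => ?_]
    · exact C.reachable cs hM
    · obtain ⟨i, hi, rfl⟩ := (hS b).mp (Finset.mem_univ b)
      exact Or.inr ⟨i, hi, rfl⟩
  · have hcover : ∀ b, b = r ∨ ∃ i < n, v i = b := fun b => (hS b).mp (Finset.mem_univ b)
    have htop : ∀ u : ℕ → B, (∀ b, b = r ∨ ∃ i < n, u i = b) →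
        initialSubgroup {cs.simple r} (fun i => cs.simple (u i)) n = ⊤ := by
      intro u hu
      refine eq_top_of_cover cs fun b => ?_
      rcases hu b with rfl | ⟨i, hi, rfl⟩
      · exact Or.inl rfl
      · exact Or.inr ⟨i, hi, rfl⟩
    rcases le_or_gt (2 * k + 1) n with hk | hk
    · rw [← htop v hcover]
      exact T.reachable_of_le cs hM hk hcover hE₆ hE₇ hE₈
    · have hcover' : ∀ b, b = r ∨ ∃ i < n, v (n - 1 - i) = b := fun b =>
        (hcover b).imp_right exists_lt_reverse.mpr
      rw [← htop _ hcover']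
      have := T.lt
      exact T.reverse.reachable_of_le cs hM (by omega) hcover' hE₆ hE₇ hE₈

end Conclusion

end Mixing

theorem mainTheorem5 {B : Type*} [Finite B] (M : CoxeterMatrix B)
    {G : Type*} [Group G] [Finite G] (cs : CoxeterSystem M G)
    (hirr : Mixing.IsIrreducible M)
    (hE₆ : ¬ Mixing.HasType M CoxeterMatrix.E₆)
    (hE₇ : ¬ Mixing.HasType M CoxeterMatrix.E₇)
    (hE₈ : ¬ Mixing.HasType M CoxeterMatrix.E₈) :
    Mixing.IsMixable G := by
  classical
  have := Fintype.ofFinite B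
  have := Fintype.ofFinite G
  exact Mixing.isMixable_of_reachable_top (Mixing.reachable_top cs hirr hE₆ hE₇ hE₈)
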